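/- **Theorem (completeness of the categorical semantics of $\lambda_{\mathrm{eff}}$).** *Types.* Fix a set of operation symbols. Value types are $A,B ::= A\to C\mid\prod_{i=1}^nA_i$ ($n\ge 0$), computation types are $C ::= A\,!\,\Sigma$, and a signature $\Sigma$ is a finite partial function from operation symbols to pairs of value types; write $(\mathtt{op}:A_{\mathtt{op}}\rightarrowtriangle B_{\mathtt{op}})\in\Sigma$. Contexts are lists $\Gamma=x_1:A_1,\dots,x_n:A_n$. *Terms.* Terms carry their typing derivations and are taken up to $\alpha$-equivalence. Value terms $\Gamma\vdash V:A$ are variables, $\lambda x.M:A\to C$ (for $\Gamma,x:A\vdash M:C$), tuples $\langle V_1,\dots,V_n\rangle$ and projections $\pi_iV$. Computation terms $\Gamma\vdash M:C$ are $V\,W:C$ (for $V:A\to C$, $W:A$); $\mathtt{return}\,V:A!\Sigma$; $\mathtt{let}\,x=M\,\mathtt{in}\,N:B!\Sigma$ (for $M:A!\Sigma$, $\Gamma,x:A\vdash N:B!\Sigma$); $\mathtt{op}(V):B_{\mathtt{op}}!\Sigma$ (for $\mathtt{op}\in\Sigma$, $V:A_{\mathtt{op}}$); and $\mathtt{handle}\,M\,\mathtt{with}\,H\,\mathtt{to}\,x.N:C$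 (for $M:A!\Sigma$, $\Gamma\vdash H:\Sigma\Rightarrow C$, $\Gamma,x:A\vdash N:C$). A handler $\Gamma\vdash H:\Sigma\Rightarrow C$ consists of exactly one clause $\mathtt{op}(x,k)\mapsto M_{\mathtt{op}}$ for each $\mathtt{op}\in\Sigma$, where $\Gamma,x:A_{\mathtt{op}},k:B_{\mathtt{op}}\to C\vdash M_{\mathtt{op}}:C$. *Equational theory.* The judgements $\Gamma\vdash V=W:A$, $\Gamma\vdash M=N:C$, $\Gamma\vdash H=H':\Sigma\Rightarrow C$ form the least typed congruence (reflexive, symmetric, transitive, compatible with all term constructors) containing $$(\lambda x.M)V=M[V/x],\quad V=\lambda x.(V\,x),\quad \pi_i\langle V_1,\dots,V_n\rangle=V_i,\quad V=\langle\pi_1V,\dots,\pi_nV\rangle,$$ $$\mathtt{let}\,x=\mathtt{return}\,V\,\mathtt{in}\,M=M[V/x],\qquad \mathtt{let}\,x=M\,\mathtt{in}\,\mathtt{return}\,x=M,$$ $$\mathtt{let}\,y=(\mathtt{let}\,x=M\,\mathtt{in}\,N)\,\mathtt{in}\,L=\mathtt{let}\,x=M\,\mathtt{in}\,\mathtt{let}\,y=N\,\mathtt{in}\,L,$$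 $$\mathtt{handle}\,\mathtt{return}\,V\,\mathtt{with}\,H\,\mathtt{to}\,x.M=M[V/x],$$ $$\mathtt{handle}\,(\mathtt{let}\,x=L\,\mathtt{in}\,M)\,\mathtt{with}\,H\,\mathtt{to}\,y.N=\mathtt{handle}\,L\,\mathtt{with}\,H\,\mathtt{to}\,x.(\mathtt{handle}\,M\,\mathtt{with}\,H\,\mathtt{to}\,y.N),$$ $$\mathtt{handle}\,\mathtt{op}(V)\,\mathtt{with}\,H\,\mathtt{to}\,x.M=M_{\mathtt{op}}[V/x,\ \lambda x.M/k]\quad\text{for }(\mathtt{op}(x,k)\mapsto M_{\mathtt{op}})\in H.$$ *Models.* A semantic signature in a category $\mathcal C$ is a finite partial function $S$ from operation symbols to pairs of objects. A $\lambda_{\mathrm{eff}}$-model consists of - a category $\mathcal C$ with chosen finite products; - for each semantic signature $S$, a strong monad $T_S=(T_S,\eta,\mu,\mathrm{st})$ on $\mathcal C$ with chosen Kleisli exponentials $Y\Rightarrow_SZ$, that is, bijections $\Lambda:\mathcal C(X\times Y,T_SZ)\cong\mathcal C(X,Y\Rightarrow_SZ)$ natural in $X$; put $\mathrm{ev}=\Lambda^{-1}(\mathrm{id})$;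 - for each $S$ and $(\mathtt{op}:A\rightarrowtriangle B)\in S$, a morphism $[\![\mathtt{op}]\!]_S:A\to T_SB$; - for all $S,S'$ and each object $X$, a morphism $\mathbf{handle}_{S,S',X}:\mathcal H\times T_ST_{S'}X\to T_{S'}X$, where $\mathcal H=\mathcal H_{S,S',X}=\prod_{(\mathtt{op}:A\rightarrowtriangle B)\in S}\big((A\times(B\Rightarrow_{S'}X))\Rightarrow_{S'}X\big)$, such that $$\mathbf{handle}\circ(\mathrm{id}\times\eta)=\pi_2,\qquad \mathbf{handle}\circ(\mathrm{id}\times\mu)=\mathbf{handle}\circ(\mathrm{id}\times T_S\mathbf{handle})\circ\langle\pi_1,\mathrm{st}\rangle,$$ $$\mathbf{handle}\circ\big(\mathrm{id}\times(T_S\mathrm{ev}\circ\mathrm{st}\circ\mathrm{swap}\circ([\![\mathtt{op}]\!]_S\times\mathrm{id}))\big)=\mathrm{ev}\circ(\pi_{\mathtt{op}}\times\mathrm{id})\quad\text{for each }\mathtt{op}\in S.$$ *Interpretation.* In a model, $[\![\prod_iA_i]\!]=\prod_i[\![A_i]\!]$, $[\![A\to B!\Sigma]\!]=[\![A]\!]\Rightarrow_{[\![\Sigma]\!]}[\![B]\!]$,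 $[\![\Sigma]\!]$ is obtained by interpreting the types in $\Sigma$, $[\![\cdot]\!]=1$ and $[\![\Gamma,x:A]\!]=[\![\Gamma]\!]\times[\![A]\!]$. Terms are interpreted as morphisms $[\![V]\!]:[\![\Gamma]\!]\to[\![A]\!]$, $[\![M]\!]:[\![\Gamma]\!]\to T_{[\![\Sigma]\!]}[\![A]\!]$ for $M:A!\Sigma$, and $[\![H]\!]:[\![\Gamma]\!]\to\mathcal H_{[\![\Sigma]\!],[\![\Sigma']\!],[\![A]\!]}$ for $H:\Sigma\Rightarrow A!\Sigma'$. Variables, tuples and projections are interpreted by the product structure, and $$[\![\lambda x.M]\!]=\Lambda[\![M]\!],\quad [\![V\,W]\!]=\mathrm{ev}\circ\langle[\![V]\!],[\![W]\!]\rangle,\quad [\![\mathtt{return}\,V]\!]=\eta\circ[\![V]\!],\quad [\![\mathtt{op}(V)]\!]=[\![\mathtt{op}]\!]_{[\![\Sigma]\!]}\circ[\![V]\!],$$ $$[\![\mathtt{let}\,x=M\,\mathtt{in}\,N]\!]=\mu\circ T[\![N]\!]\circ\mathrm{st}\circ\langle\mathrm{id},[\![M]\!]\rangle,$$ $$[\![H]\!]=\langle\Lambda([\![M_{\mathtt{op}}]\!]\circ\alpha^{-1})\rangle_{\mathtt{op}\in\Sigma},\qquad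 [\![\mathtt{handle}\,M\,\mathtt{with}\,H\,\mathtt{to}\,x.N]\!]=\mathbf{handle}\circ\langle[\![H]\!],\,T[\![N]\!]\circ\mathrm{st}\circ\langle\mathrm{id},[\![M]\!]\rangle\rangle,$$ where $T=T_{[\![\Sigma]\!]}$ with $\Sigma$ the signature of $M$, and $\alpha:(X\times Y)\times Z\to X\times(Y\times Z)$ is the associator. *Claim.* Let $\Gamma$ be a context. 1. If $\Gamma\vdash V:A$ and $\Gamma\vdash W:A$ are value terms with $[\![V]\!]=[\![W]\!]$ in every $\lambda_{\mathrm{eff}}$-model, then $\Gamma\vdash V=W:A$ is derivable. 2. If $\Gamma\vdash M:C$ and $\Gamma\vdash N:C$ are computation terms with $[\![M]\!]=[\![N]\!]$ in every $\lambda_{\mathrm{eff}}$-model, then $\Gamma\vdash M=N:C$ is derivable. 3. If $\Gamma\vdash H:\Sigma\Rightarrow C$ and $\Gamma\vdash H':\Sigma\Rightarrow C$ are handlers with $[\![H]\!]=[\![H']\!]$ in every $\lambda_{\mathrm{eff}}$-model, then $\Gamma\vdash H=H':\Sigma\Rightarrow C$ is derivable. -/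

import Mathlib

-- so that `X ⟶ Y` elaborates to the morphisms of the category, not of its reflexive quiver
attribute [-instance] CategoryTheory.catToReflQuiver

namespace EffCalc

open CategoryTheory CategoryTheory.Limits MonoidalCategory CartesianMonoidalCategory

universe u v

/-! ### Signatures and types -/

/-- A signature over a collection `X`: a partial function with finite domain from operation
symbols to pairs of elements of `X`. With `X` the value types these are the syntactic signatures,
with `X` the objects of a category they are the semantic signatures. -/
structure Signature (Op : Type u) (X : Type v) where
  /-- the operation symbols of the signature -/
  dom : Finset Op
  /-- the argument type of an operation -/
  arg : {o // o ∈ dom} → X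
  /-- the return type of an operation -/
  res : {o // o ∈ dom} → X

/-- Value types: finite products `∏ i, A i`, and function types `A → B ! Σ`, where the signature
`Σ` is spelled out as in `Signature`. -/
inductive Ty (Op : Type u) : Type u
  | prod {n : ℕ} (A : Fin n → Ty Op) : Ty Op
  | arr (A B : Ty Op) (dom : Finset Op) (arg res : {o // o ∈ dom} → Ty Op) : Ty Op

/-- Syntactic signatures. -/
abbrev Sig (Op : Type u) : Type u := Signature Op (Ty Op)

/-- Computation types `A ! Σ`. -/
structure CTy (Op : Type u) : Type u where
  val : Ty Op
  sig : Sig Op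

/-- The function type `A → C`. -/
abbrev Ty.fn {Op : Type u} (A : Ty Op) (C : CTy Op) : Ty Op :=
  .arr A C.val C.sig.dom C.sig.arg C.sig.res

/-- Contexts; the most recently bound variable comes first. -/
abbrev Ctx (Op : Type u) : Type u := List (Ty Op)

/-! ### Terms

Terms are represented up to `α`-equivalence, by typing derivations with de Bruijn indices. -/

/-- `Var Γ A`: the variables of type `A` in `Γ`. -/
inductive Var {Op : Type u} : Ctx Op → Ty Op → Type u
  | zero {Γ : Ctx Op} {A : Ty Op} : Var (A :: Γ) A
  | succ {Γ : Ctx Op} {A B : Ty Op} : Var Γ A → Var (B :: Γ) A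

mutual

/-- Value terms `Γ ⊢ V : A`. -/
inductive Val {Op : Type u} : Ctx Op → Ty Op → Type u
  | var {Γ : Ctx Op} {A : Ty Op} : Var Γ A → Val Γ A
  | lam {Γ : Ctx Op} {A : Ty Op} {C : CTy Op} : Comp (A :: Γ) C → Val Γ (Ty.fn A C)
  | tuple {Γ : Ctx Op} {n : ℕ} {A : Fin n → Ty Op} : (∀ i, Val Γ (A i)) → Val Γ (Ty.prod A)
  | proj {Γ : Ctx Op} {n : ℕ} {A : Fin n → Ty Op} (i : Fin n) : Val Γ (Ty.prod A) → Val Γ (A i)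

/-- Computation terms `Γ ⊢ M : C`; `handle M H N` is `handle M with H to x. N`. -/
inductive Comp {Op : Type u} : Ctx Op → CTy Op → Type u
  | app {Γ : Ctx Op} {A : Ty Op} {C : CTy Op} : Val Γ (Ty.fn A C) → Val Γ A → Comp Γ C
  | ret {Γ : Ctx Op} {A : Ty Op} {S : Sig Op} : Val Γ A → Comp Γ ⟨A, S⟩
  | letIn {Γ : Ctx Op} {A B : Ty Op} {S : Sig Op} :
      Comp Γ ⟨A, S⟩ → Comp (A :: Γ) ⟨B, S⟩ → Comp Γ ⟨B, S⟩
  | op {Γ : Ctx Op} {S : Sig Op} (o : {o // o ∈ S.dom}) : Val Γ (S.arg o) → Comp Γ ⟨S.res o, S⟩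
  | handle {Γ : Ctx Op} {A : Ty Op} {S : Sig Op} {C : CTy Op} :
      Comp Γ ⟨A, S⟩ → Handler Γ S C → Comp (A :: Γ) C → Comp Γ C

/-- Handlers `Γ ⊢ H : Σ ⇒ C`: one clause `op(x, k) ↦ M_op` for each operation of `Σ`, where
`Γ, x : A_op, k : B_op → C ⊢ M_op : C`. -/
inductive Handler {Op : Type u} : Ctx Op → Sig Op → CTy Op → Type u
  | mk {Γ : Ctx Op} {S : Sig Op} {C : CTy Op} :
      (∀ o : {o // o ∈ S.dom}, Comp (Ty.fn (S.res o) C :: S.arg o :: Γ) C) → Handler Γ S C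

end

/-! ### Renaming and substitution -/

/-- Renamings of the variables of `Γ` by variables of `Δ`. -/
abbrev Ren {Op : Type u} (Γ Δ : Ctx Op) : Type u := ∀ ⦃A : Ty Op⦄, Var Γ A → Var Δ A

/-- Extension of a renaming under a binder. -/
def Ren.up {Op : Type u} {Γ Δ : Ctx Op} {B : Ty Op} (ρ : Ren Γ Δ) : Ren (B :: Γ) (B :: Δ)
  | _, .zero => .zero
  | _, .succ x => .succ (ρ x)

/-- The weakening renaming. -/
def Ren.wk {Op : Type u} {Γ : Ctx Op} {B : Ty Op} : Ren Γ (B :: Γ) := fun _ x => .succ x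

mutual

/-- Renaming in value terms. -/
def Val.rename {Op : Type u} : {Γ Δ : Ctx Op} → {A : Ty Op} → Val Γ A → Ren Γ Δ → Val Δ A
  | _, _, _, .var x, ρ => .var (ρ x)
  | _, _, _, .lam M, ρ => .lam (M.rename ρ.up)
  | _, _, _, .tuple V, ρ => .tuple fun i => (V i).rename ρ
  | _, _, _, .proj (A := _) i V, ρ => .proj i (V.rename ρ)

/-- Renaming in computation terms. -/
def Comp.rename {Op : Type u} : {Γ Δ : Ctx Op} → {C : CTy Op} → Comp Γ C → Ren Γ Δ → Comp Δ C
  | _, _, _, .app V W, ρ => .app (V.rename ρ) (W.rename ρ)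
  | _, _, _, .ret V, ρ => .ret (V.rename ρ)
  | _, _, _, .letIn M N, ρ => .letIn (M.rename ρ) (N.rename ρ.up)
  | _, _, _, .op o V, ρ => .op o (V.rename ρ)
  | _, _, _, .handle M H N, ρ => .handle (M.rename ρ) (H.rename ρ) (N.rename ρ.up)

/-- Renaming in handlers. -/
def Handler.rename {Op : Type u} :
    {Γ Δ : Ctx Op} → {S : Sig Op} → {C : CTy Op} → Handler Γ S C → Ren Γ Δ → Handler Δ S C
  | _, _, _, _, .mk M, ρ => .mk fun o => (M o).rename ρ.up.up

end

/-- Substitutions of value terms over `Δ` for the variables of `Γ`. -/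
abbrev Sub {Op : Type u} (Γ Δ : Ctx Op) : Type u := ∀ ⦃A : Ty Op⦄, Var Γ A → Val Δ A

/-- Extension of a substitution under a binder. -/
def Sub.up {Op : Type u} {Γ Δ : Ctx Op} {B : Ty Op} (σ : Sub Γ Δ) : Sub (B :: Γ) (B :: Δ)
  | _, .zero => .var .zero
  | _, .succ x => (σ x).rename Ren.wk

/-- The identity substitution. -/
def Sub.id {Op : Type u} {Γ : Ctx Op} : Sub Γ Γ := fun _ x => .var x

/-- The substitution that maps the last variable to `V` and is `σ` on the others. -/
def Sub.cons {Op : Type u} {Γ Δ : Ctx Op} {B : Ty Op} (σ : Sub Γ Δ) (V : Val Δ B) :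
    Sub (B :: Γ) Δ
  | _, .zero => V
  | _, .succ x => σ x

mutual

/-- Substitution in value terms. -/
def Val.subst {Op : Type u} : {Γ Δ : Ctx Op} → {A : Ty Op} → Val Γ A → Sub Γ Δ → Val Δ A
  | _, _, _, .var x, σ => σ x
  | _, _, _, .lam M, σ => .lam (M.subst σ.up)
  | _, _, _, .tuple V, σ => .tuple fun i => (V i).subst σ
  | _, _, _, .proj (A := _) i V, σ => .proj i (V.subst σ)

/-- Substitution in computation terms. -/
def Comp.subst {Op : Type u} : {Γ Δ : Ctx Op} → {C : CTy Op} → Comp Γ C → Sub Γ Δ → Comp Δ C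
  | _, _, _, .app V W, σ => .app (V.subst σ) (W.subst σ)
  | _, _, _, .ret V, σ => .ret (V.subst σ)
  | _, _, _, .letIn M N, σ => .letIn (M.subst σ) (N.subst σ.up)
  | _, _, _, .op o V, σ => .op o (V.subst σ)
  | _, _, _, .handle M H N, σ => .handle (M.subst σ) (H.subst σ) (N.subst σ.up)

/-- Substitution in handlers. -/
def Handler.subst {Op : Type u} :
    {Γ Δ : Ctx Op} → {S : Sig Op} → {C : CTy Op} → Handler Γ S C → Sub Γ Δ → Handler Δ S C
  | _, _, _, _, .mk M, σ => .mk fun o => (M o).subst σ.up.up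

end

/-- `M[V/x]` for the last variable `x` of the context. -/
abbrev Comp.inst {Op : Type u} {Γ : Ctx Op} {A : Ty Op} {C : CTy Op}
    (M : Comp (A :: Γ) C) (V : Val Γ A) : Comp Γ C :=
  M.subst (Sub.id.cons V)

/-- `M[V/x, W/k]` for the last two variables `x, k` of the context. -/
abbrev Comp.inst₂ {Op : Type u} {Γ : Ctx Op} {A B : Ty Op} {C : CTy Op}
    (M : Comp (B :: A :: Γ) C) (V : Val Γ A) (W : Val Γ B) : Comp Γ C :=
  M.subst ((Sub.id.cons V).cons W)

/-! ### Equational theory -/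

mutual

/-- Derivability of `Γ ⊢ V = W : A`. -/
inductive ValEq {Op : Type u} : {Γ : Ctx Op} → {A : Ty Op} → Val Γ A → Val Γ A → Prop
  | refl {Γ : Ctx Op} {A : Ty Op} (V : Val Γ A) : ValEq V V
  | symm {Γ : Ctx Op} {A : Ty Op} {V W : Val Γ A} : ValEq V W → ValEq W V
  | trans {Γ : Ctx Op} {A : Ty Op} {U V W : Val Γ A} : ValEq U V → ValEq V W → ValEq U W
  | lam_congr {Γ : Ctx Op} {A : Ty Op} {C : CTy Op} {M N : Comp (A :: Γ) C} :
      CompEq M N → ValEq (.lam M) (.lam N)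
  | tuple_congr {Γ : Ctx Op} {n : ℕ} {A : Fin n → Ty Op} {V W : ∀ i, Val Γ (A i)} :
      (∀ i, ValEq (V i) (W i)) → ValEq (.tuple V) (.tuple W)
  | proj_congr {Γ : Ctx Op} {n : ℕ} {A : Fin n → Ty Op} (i : Fin n) {V W : Val Γ (Ty.prod A)} :
      ValEq V W → ValEq (.proj i V) (.proj i W)
  | abs_eta {Γ : Ctx Op} {A : Ty Op} {C : CTy Op} (V : Val Γ (Ty.fn A C)) :
      ValEq V (.lam (.app (V.rename Ren.wk) (.var .zero)))
  | prod_beta {Γ : Ctx Op} {n : ℕ} {A : Fin n → Ty Op} (i : Fin n) (V : ∀ i, Val Γ (A i)) :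
      ValEq (.proj i (.tuple V)) (V i)
  | prod_eta {Γ : Ctx Op} {n : ℕ} {A : Fin n → Ty Op} (V : Val Γ (Ty.prod A)) :
      ValEq V (.tuple fun i => .proj i V)

/-- Derivability of `Γ ⊢ M = N : C`. -/
inductive CompEq {Op : Type u} : {Γ : Ctx Op} → {C : CTy Op} → Comp Γ C → Comp Γ C → Prop
  | refl {Γ : Ctx Op} {C : CTy Op} (M : Comp Γ C) : CompEq M M
  | symm {Γ : Ctx Op} {C : CTy Op} {M N : Comp Γ C} : CompEq M N → CompEq N M
  | trans {Γ : Ctx Op} {C : CTy Op} {L M N : Comp Γ C} : CompEq L M → CompEq M N → CompEq L N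
  | app_congr {Γ : Ctx Op} {A : Ty Op} {C : CTy Op} {V V' : Val Γ (Ty.fn A C)} {W W' : Val Γ A} :
      ValEq V V' → ValEq W W' → CompEq (.app V W) (.app V' W')
  | ret_congr {Γ : Ctx Op} {A : Ty Op} {S : Sig Op} {V W : Val Γ A} :
      ValEq V W → CompEq (.ret (S := S) V) (.ret W)
  | let_congr {Γ : Ctx Op} {A B : Ty Op} {S : Sig Op} {M M' : Comp Γ ⟨A, S⟩}
      {N N' : Comp (A :: Γ) ⟨B, S⟩} :
      CompEq M M' → CompEq N N' → CompEq (.letIn M N) (.letIn M' N')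
  | op_congr {Γ : Ctx Op} {S : Sig Op} (o : {o // o ∈ S.dom}) {V W : Val Γ (S.arg o)} :
      ValEq V W → CompEq (.op o V) (.op o W)
  | handle_congr {Γ : Ctx Op} {A : Ty Op} {S : Sig Op} {C : CTy Op} {M M' : Comp Γ ⟨A, S⟩}
      {H H' : Handler Γ S C} {N N' : Comp (A :: Γ) C} :
      CompEq M M' → HandlerEq H H' → CompEq N N' → CompEq (.handle M H N) (.handle M' H' N')
  | abs_beta {Γ : Ctx Op} {A : Ty Op} {C : CTy Op} (M : Comp (A :: Γ) C) (V : Val Γ A) :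
      CompEq (.app (.lam M) V) (M.inst V)
  | ret_let {Γ : Ctx Op} {A B : Ty Op} {S : Sig Op} (V : Val Γ A) (M : Comp (A :: Γ) ⟨B, S⟩) :
      CompEq (.letIn (.ret V) M) (M.inst V)
  | let_let {Γ : Ctx Op} {A₁ A₂ A₃ : Ty Op} {S : Sig Op} (M : Comp Γ ⟨A₁, S⟩)
      (N : Comp (A₁ :: Γ) ⟨A₂, S⟩) (L : Comp (A₂ :: Γ) ⟨A₃, S⟩) :
      CompEq (.letIn (.letIn M N) L) (.letIn M (.letIn N (L.rename (Ren.up Ren.wk))))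
  | let_ret {Γ : Ctx Op} {A : Ty Op} {S : Sig Op} (M : Comp Γ ⟨A, S⟩) :
      CompEq (.letIn M (.ret (.var .zero))) M
  | handle_ret {Γ : Ctx Op} {A : Ty Op} {S : Sig Op} {C : CTy Op} (V : Val Γ A)
      (H : Handler Γ S C) (M : Comp (A :: Γ) C) :
      CompEq (.handle (.ret V) H M) (M.inst V)
  | handle_let {Γ : Ctx Op} {A B : Ty Op} {S : Sig Op} {C : CTy Op} (H : Handler Γ S C)
      (L : Comp Γ ⟨A, S⟩) (M : Comp (A :: Γ) ⟨B, S⟩) (N : Comp (B :: Γ) C) :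
      CompEq (.handle (.letIn L M) H N)
        (.handle L H (.handle M (H.rename Ren.wk) (N.rename (Ren.up Ren.wk))))
  | handle_op {Γ : Ctx Op} {S : Sig Op} {C : CTy Op} (o : {o // o ∈ S.dom})
      (H : ∀ o : {o // o ∈ S.dom}, Comp (Ty.fn (S.res o) C :: S.arg o :: Γ) C)
      (M : Comp (S.res o :: Γ) C) (V : Val Γ (S.arg o)) :
      CompEq (.handle (.op o V) (.mk H) M) ((H o).inst₂ V (.lam M))

/-- Derivability of `Γ ⊢ H = H' : Σ ⇒ C`. -/
inductive HandlerEq {Op : Type u} :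
    {Γ : Ctx Op} → {S : Sig Op} → {C : CTy Op} → Handler Γ S C → Handler Γ S C → Prop
  | refl {Γ : Ctx Op} {S : Sig Op} {C : CTy Op} (H : Handler Γ S C) : HandlerEq H H
  | symm {Γ : Ctx Op} {S : Sig Op} {C : CTy Op} {H H' : Handler Γ S C} :
      HandlerEq H H' → HandlerEq H' H
  | trans {Γ : Ctx Op} {S : Sig Op} {C : CTy Op} {H H' H'' : Handler Γ S C} :
      HandlerEq H H' → HandlerEq H' H'' → HandlerEq H H''
  | congr {Γ : Ctx Op} {S : Sig Op} {C : CTy Op}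
      {M N : ∀ o : {o // o ∈ S.dom}, Comp (Ty.fn (S.res o) C :: S.arg o :: Γ) C} :
      (∀ o, CompEq (M o) (N o)) → HandlerEq (.mk M) (.mk N)

end

/-! ### Cartesian categories -/

/-- A cartesian category: a category with (chosen) finite products `∏_{i=1}^n X_i`. -/
class CartesianCat (C : Type u) [Category.{v} C] where
  /-- the product object -/
  pi {n : ℕ} (X : Fin n → C) : C
  /-- the projections -/
  π {n : ℕ} (X : Fin n → C) (i : Fin n) : pi X ⟶ X i
  /-- tupling -/
  tuple {n : ℕ} {X : Fin n → C} {Z : C} (f : ∀ i, Z ⟶ X i) : Z ⟶ pi X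
  tuple_π {n : ℕ} {X : Fin n → C} {Z : C} (f : ∀ i, Z ⟶ X i) (i : Fin n) : tuple f ≫ π X i = f i
  hom_ext {n : ℕ} {X : Fin n → C} {Z : C} (f g : Z ⟶ pi X) :
    (∀ i, f ≫ π X i = g ≫ π X i) → f = g

namespace CartesianCat

variable {C : Type u} [Category.{v} C] [CartesianCat C]

/-- The terminal object is the empty product. -/
def terminalCone : LimitCone (Functor.empty.{0} C) where
  cone := asEmptyCone (pi (Fin.elim0 : Fin 0 → C))
  isLimit := IsTerminal.ofUniqueHom (fun _ => tuple fun i => i.elim0)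
    fun _ _ => hom_ext _ _ fun i => i.elim0

/-- Pairing into `pi ![X, Y]`. -/
def pair {X Y Z : C} (f : Z ⟶ X) (g : Z ⟶ Y) : Z ⟶ pi ![X, Y] :=
  tuple (Fin.cons (α := fun i => Z ⟶ ![X, Y] i) f (Fin.cons (α := fun i : Fin 1 => Z ⟶ ![Y] i) g
    fun i => i.elim0))

theorem pair_π_zero {X Y Z : C} (f : Z ⟶ X) (g : Z ⟶ Y) : pair f g ≫ π ![X, Y] 0 = f :=
  tuple_π (X := ![X, Y]) _ 0

theorem pair_π_one {X Y Z : C} (f : Z ⟶ X) (g : Z ⟶ Y) : pair f g ≫ π ![X, Y] 1 = g :=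
  tuple_π (X := ![X, Y]) _ 1

/-- Binary products are the products of families of length two. -/
def pairCone (X Y : C) : LimitCone (Limits.pair X Y) where
  cone := BinaryFan.mk (P := pi ![X, Y]) (π ![X, Y] 0) (π ![X, Y] 1)
  isLimit := BinaryFan.IsLimit.mk _ (fun f g => pair f g) pair_π_zero pair_π_one
    (fun f g m hf hg => hom_ext (X := ![X, Y]) _ _ fun i => by
      refine Fin.cases ?_ (fun j => ?_) i
      · exact hf.trans (pair_π_zero f g).symm
      · obtain rfl : j = 0 := Subsingleton.elim _ _
        exact hg.trans (pair_π_one f g).symm)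

/-- The terminal object `𝟙_ C` and the binary products `X ⊗ Y`, with Mathlib's notation. -/
instance : CartesianMonoidalCategory C := .ofChosenFiniteProducts terminalCone pairCone

/-- The product of a family indexed by a finite set, along an enumeration of the set. -/
noncomputable abbrev piFinite {J : Type*} [Fintype J] (X : J → C) : C :=
  pi fun i => X ((Fintype.equivFin J).symm i)

/-- The projections of `piFinite`. -/
noncomputable def πFinite {J : Type*} [Fintype J] (X : J → C) (j : J) : piFinite X ⟶ X j :=
  π (fun i => X ((Fintype.equivFin J).symm i)) (Fintype.equivFin J j) ≫ eqToHom (by simp)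

/-- Tupling into `piFinite`. -/
noncomputable def tupleFinite {J : Type*} [Fintype J] {X : J → C} {Z : C} (f : ∀ j, Z ⟶ X j) :
    Z ⟶ piFinite X :=
  tuple fun i => f ((Fintype.equivFin J).symm i)

theorem tupleFinite_πFinite {J : Type*} [Fintype J] {X : J → C} {Z : C} (f : ∀ j, Z ⟶ X j)
    (j : J) : tupleFinite f ≫ πFinite X j = f j := by
  have aux : ∀ (j' : J) (h : j' = j), f j' ≫ eqToHom (by rw [h]) = f j := by
    rintro _ rfl
    simp
  unfold tupleFinite πFinite
  rw [← Category.assoc, tuple_π]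
  exact aux _ (by simp)

theorem piFinite_hom_ext {J : Type*} [Fintype J] {X : J → C} {Z : C} (f g : Z ⟶ piFinite X)
    (h : ∀ j, f ≫ πFinite X j = g ≫ πFinite X j) : f = g := by
  apply CartesianCat.hom_ext
  intro i
  obtain ⟨j, rfl⟩ := (Fintype.equivFin J).surjective i
  have := h j
  unfold πFinite at this
  rw [← Category.assoc, ← Category.assoc] at this
  exact (cancel_mono _).1 this

end CartesianCat

open CartesianCat

/-! ### Strong monads and Kleisli exponentials -/

/-- A strong monad `(T, η, μ, st)` on a cartesian category. -/
structure StrongMonad (C : Type u) [Category.{v} C] [CartesianMonoidalCategory C] where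
  /-- the underlying monad -/
  T : Monad C
  /-- the strength -/
  st (X Y : C) : X ⊗ T.obj Y ⟶ T.obj (X ⊗ Y)
  st_natural {X X' Y Y' : C} (f : X ⟶ X') (g : Y ⟶ Y') :
    (f ⊗ₘ T.map g) ≫ st X' Y' = st X Y ≫ T.map (f ⊗ₘ g)
  st_leftUnitor (X : C) : st (𝟙_ C) X ≫ T.map (λ_ X).hom = (λ_ (T.obj X)).hom
  st_associator (X Y Z : C) :
    st (X ⊗ Y) Z ≫ T.map (α_ X Y Z).hom =
      (α_ X Y (T.obj Z)).hom ≫ (X ◁ st Y Z) ≫ st X (Y ⊗ Z)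
  st_unit (X Y : C) : (X ◁ T.η.app Y) ≫ st X Y = T.η.app (X ⊗ Y)
  st_mult (X Y : C) :
    (X ◁ T.μ.app Y) ≫ st X Y = st X (T.obj Y) ≫ T.map (st X Y) ≫ T.μ.app (X ⊗ Y)

/-- A Kleisli exponential `Y ⇒_T Z`: an object with bijections `C(X × Y, T Z) ≅ C(X, Y ⇒_T Z)`
natural in `X`. -/
structure KleisliExp {C : Type u} [Category.{v} C] [CartesianMonoidalCategory C]
    (T : Monad C) (Y Z : C) where
  /-- the exponential object -/
  obj : C
  /-- currying -/
  curry {X : C} : (X ⊗ Y ⟶ T.obj Z) ≃ (X ⟶ obj)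
  curry_natural {X X' : C} (f : X ⟶ X') (g : X' ⊗ Y ⟶ T.obj Z) :
    curry ((f ▷ Y) ≫ g) = f ≫ curry g

/-- The evaluation morphism `(Y ⇒_T Z) × Y ⟶ T Z`. -/
def KleisliExp.eval {C : Type u} [Category.{v} C] [CartesianMonoidalCategory C]
    {T : Monad C} {Y Z : C} (E : KleisliExp T Y Z) : E.obj ⊗ Y ⟶ T.obj Z :=
  E.curry.symm (𝟙 E.obj)

/-! ### Models -/

section Bundle

variable {Op : Type u} {C : Type u} [Category.{u} C] [CartesianCat C]

/-- The factor `(A_op × (B_op ⇒_T X)) ⇒_T X` of the object of handlers. -/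
abbrev clauseObj {T : StrongMonad C} (E : ∀ Y Z : C, KleisliExp T.T Y Z)
    (S : Signature Op C) (X : C) (o : {o // o ∈ S.dom}) : C :=
  (E (S.arg o ⊗ (E (S.res o) X).obj) X).obj

/-- The object of handlers: the product of `clauseObj` over the operations of `S`. -/
noncomputable abbrev HBundle {T : StrongMonad C} (E : ∀ Y Z : C, KleisliExp T.T Y Z)
    (S : Signature Op C) (X : C) : C :=
  piFinite (clauseObj E S X)

/-- The morphism `A × (B ⇒_{T'} X) ⟶ T (T' X)` induced by `f : A ⟶ T B`. -/
def mixedOp {T T' : StrongMonad C} (E' : ∀ Y Z : C, KleisliExp T'.T Y Z) {A B : C}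
    (f : A ⟶ T.T.obj B) (X : C) : A ⊗ (E' B X).obj ⟶ T.T.obj (T'.T.obj X) :=
  (f ▷ (E' B X).obj) ≫ lift (snd _ _) (fst _ _) ≫ T.st _ _ ≫ T.T.map (E' B X).eval

end Bundle

/-- Models of the calculus with operation symbols `Op`. Finite products and Kleisli exponentials
are chosen, since the interpretation of types refers to them. The category is small relative to
the universe of `Op`; quantifying over these models only makes a completeness claim stronger. -/
structure Model (Op : Type u) where
  /-- the objects -/
  C : Type u
  [cat : Category.{u} C]
  [cart : CartesianCat C]
  /-- the strong monads, indexed by semantic signatures -/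
  T : Signature Op C → StrongMonad C
  /-- the Kleisli exponentials -/
  exp (S : Signature Op C) (Y Z : C) : KleisliExp (T S).T Y Z
  /-- the interpretation of operations -/
  op (S : Signature Op C) (o : {o // o ∈ S.dom}) : S.arg o ⟶ (T S).T.obj (S.res o)
  /-- the handling morphisms -/
  handle (S S' : Signature Op C) (X : C) :
    HBundle (exp S') S X ⊗ (T S).T.obj ((T S').T.obj X) ⟶ (T S').T.obj X
  handle_unit (S S' : Signature Op C) (X : C) :
    (HBundle (exp S') S X ◁ (T S).T.η.app ((T S').T.obj X)) ≫ handle S S' X = snd _ _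
  handle_mult (S S' : Signature Op C) (X : C) :
    (HBundle (exp S') S X ◁ (T S).T.μ.app ((T S').T.obj X)) ≫ handle S S' X =
      lift (fst _ _) ((T S).st _ _) ≫
        (HBundle (exp S') S X ◁ (T S).T.map (handle S S' X)) ≫ handle S S' X
  handle_op (S S' : Signature Op C) (X : C) (o : {o // o ∈ S.dom}) :
    (HBundle (exp S') S X ◁ mixedOp (exp S') (op S o) X) ≫ handle S S' X =
      (πFinite (clauseObj (exp S') S X) o ▷ (S.arg o ⊗ (exp S' (S.res o) X).obj)) ≫
        (exp S' _ X).eval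

attribute [instance] Model.cat Model.cart

/-! ### Interpretation -/

namespace Model

variable {Op : Type u} (𝓜 : Model Op)

/-- Interpretation of value types. -/
@[reducible] def ty : Ty Op → 𝓜.C
  | .prod A => pi fun i => ty (A i)
  | .arr A B dom arg res =>
      (𝓜.exp ⟨dom, fun o => ty (arg o), fun o => ty (res o)⟩ (ty A) (ty B)).obj

/-- Interpretation of signatures. -/
abbrev sig (S : Sig Op) : Signature Op 𝓜.C :=
  ⟨S.dom, fun o => 𝓜.ty (S.arg o), fun o => 𝓜.ty (S.res o)⟩

/-- The strong monad `T_⟦Σ⟧`. -/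
abbrev TS (S : Sig Op) : StrongMonad 𝓜.C := 𝓜.T (𝓜.sig S)

/-- The object `T_⟦Σ⟧ ⟦A⟧` for a computation type `A ! Σ`. -/
abbrev cty (C : CTy Op) : 𝓜.C := (𝓜.TS C.sig).T.obj (𝓜.ty C.val)

/-- The object of handlers of type `Σ ⇒ C`. -/
noncomputable abbrev hty (S : Sig Op) (C : CTy Op) : 𝓜.C :=
  HBundle (𝓜.exp (𝓜.sig C.sig)) (𝓜.sig S) (𝓜.ty C.val)

/-- Interpretation of contexts. -/
@[reducible] def ctx : Ctx Op → 𝓜.C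
  | [] => 𝟙_ 𝓜.C
  | A :: Γ => ctx Γ ⊗ 𝓜.ty A

/-- Interpretation of variables. -/
def var : {Γ : Ctx Op} → {A : Ty Op} → Var Γ A → (𝓜.ctx Γ ⟶ 𝓜.ty A)
  | _, _, .zero => snd _ _
  | _, _, .succ x => fst _ _ ≫ var x

/-- The Kleisli exponential that interprets `A → C`. -/
abbrev fnExp (A : Ty Op) (C : CTy Op) :
    KleisliExp (𝓜.TS C.sig).T (𝓜.ty A) (𝓜.ty C.val) :=
  𝓜.exp (𝓜.sig C.sig) (𝓜.ty A) (𝓜.ty C.val)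

mutual

/-- Interpretation of value terms. -/
noncomputable def val : {Γ : Ctx Op} → {A : Ty Op} → Val Γ A → (𝓜.ctx Γ ⟶ 𝓜.ty A)
  | _, _, .var x => 𝓜.var x
  | _, _, .lam (A := A) (C := C) M => (𝓜.fnExp A C).curry (comp M)
  | _, _, .tuple V => tuple fun i => val (V i)
  | _, _, .proj (A := A) i V => val V ≫ π (fun i => 𝓜.ty (A i)) i

/-- Interpretation of computation terms. -/
noncomputable def comp : {Γ : Ctx Op} → {C : CTy Op} → Comp Γ C → (𝓜.ctx Γ ⟶ 𝓜.cty C)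
  | _, _, .app (A := A) (C := C) V W => lift (val V) (val W) ≫ (𝓜.fnExp A C).eval
  | _, _, .ret (S := S) V => val V ≫ (𝓜.TS S).T.η.app _
  | Γ, _, .letIn (A := A) (S := S) M N =>
      lift (𝟙 _) (comp M) ≫ (𝓜.TS S).st (𝓜.ctx Γ) (𝓜.ty A) ≫ (𝓜.TS S).T.map (comp N) ≫
        (𝓜.TS S).T.μ.app _
  | _, _, .op (S := S) o V => val V ≫ 𝓜.op (𝓜.sig S) o
  | Γ, _, .handle (A := A) (S := S) (C := C) M H N =>
      lift (handler H)
          (lift (𝟙 _) (comp M) ≫ (𝓜.TS S).st (𝓜.ctx Γ) (𝓜.ty A) ≫ (𝓜.TS S).T.map (comp N)) ≫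
        𝓜.handle (𝓜.sig S) (𝓜.sig C.sig) (𝓜.ty C.val)

/-- Interpretation of handlers. -/
noncomputable def handler :
    {Γ : Ctx Op} → {S : Sig Op} → {C : CTy Op} → Handler Γ S C → (𝓜.ctx Γ ⟶ 𝓜.hty S C)
  | Γ, _, _, .mk (S := S) (C := C) M =>
      tupleFinite fun o =>
        (𝓜.exp (𝓜.sig C.sig) (𝓜.ty (S.arg o) ⊗ (𝓜.fnExp (S.res o) C).obj) (𝓜.ty C.val)).curry
          ((α_ (𝓜.ctx Γ) (𝓜.ty (S.arg o)) (𝓜.fnExp (S.res o) C).obj).inv ≫ comp (M o))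

end

end Model

end EffCalc

namespace EffCalc

open CategoryTheory CategoryTheory.Limits MonoidalCategory CartesianMonoidalCategory

open CartesianCat

universe u

variable {Op : Type u}

/-! ### Substitution lemmas for raw terms -/

/-- The substitution that acts as a renaming. -/
def Ren.toSub {Γ Δ : Ctx Op} (ρ : Ren Γ Δ) : Sub Γ Δ := fun _ x => .var (ρ x)

/-- Composition of substitutions. -/
def Sub.comp {Γ Δ Θ : Ctx Op} (σ : Sub Γ Δ) (τ : Sub Δ Θ) : Sub Γ Θ := fun _ x => (σ x).subst τ

theorem Ren.toSub_up {Γ Δ : Ctx Op} {B : Ty Op} (ρ : Ren Γ Δ) :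
    (ρ.up : Ren (B :: Γ) (B :: Δ)).toSub = ρ.toSub.up := by
  funext A x
  cases x <;> rfl

theorem Sub.id_up {Γ : Ctx Op} {B : Ty Op} : (Sub.id : Sub Γ Γ).up (B := B) = Sub.id := by
  funext A x
  cases x <;> rfl

mutual

theorem Val.rename_eq_subst {Γ Δ : Ctx Op} {A : Ty Op} :
    ∀ (V : Val Γ A) (ρ : Ren Γ Δ), V.rename ρ = V.subst ρ.toSub
  | .var x, ρ => by simp only [Val.rename, Val.subst, Ren.toSub]
  | .lam M, ρ => by
      simp only [Val.rename, Val.subst, ← Ren.toSub_up, Comp.rename_eq_subst M]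
  | .tuple V, ρ => by
      simp only [Val.rename, Val.subst, fun i => Val.rename_eq_subst (V i) ρ]
  | .proj (A := _) i V, ρ => by simp only [Val.rename, Val.subst, Val.rename_eq_subst V]

theorem Comp.rename_eq_subst {Γ Δ : Ctx Op} {C : CTy Op} :
    ∀ (M : Comp Γ C) (ρ : Ren Γ Δ), M.rename ρ = M.subst ρ.toSub
  | .app V W, ρ => by
      simp only [Comp.rename, Comp.subst, Val.rename_eq_subst V, Val.rename_eq_subst W]
  | .ret V, ρ => by simp only [Comp.rename, Comp.subst, Val.rename_eq_subst V]
  | .letIn M N, ρ => by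
      simp only [Comp.rename, Comp.subst, ← Ren.toSub_up, Comp.rename_eq_subst M,
        Comp.rename_eq_subst N]
  | .op o V, ρ => by simp only [Comp.rename, Comp.subst, Val.rename_eq_subst V]
  | .handle M H N, ρ => by
      simp only [Comp.rename, Comp.subst, ← Ren.toSub_up, Comp.rename_eq_subst M,
        Handler.rename_eq_subst H, Comp.rename_eq_subst N]

theorem Handler.rename_eq_subst {Γ Δ : Ctx Op} {S : Sig Op} {C : CTy Op} :
    ∀ (H : Handler Γ S C) (ρ : Ren Γ Δ), H.rename ρ = H.subst ρ.toSub
  | .mk M, ρ => by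
      simp only [Handler.rename, Handler.subst, ← Ren.toSub_up,
        fun o => Comp.rename_eq_subst (M o) ρ.up.up]

end

mutual

theorem Val.subst_id {Γ : Ctx Op} {A : Ty Op} : ∀ V : Val Γ A, V.subst Sub.id = V
  | .var x => by simp only [Val.subst, Sub.id]
  | .lam M => by simp only [Val.subst, Sub.id_up, Comp.subst_id M]
  | .tuple V => by simp only [Val.subst, fun i => Val.subst_id (V i)]
  | .proj (A := _) i V => by simp only [Val.subst, Val.subst_id V]

theorem Comp.subst_id {Γ : Ctx Op} {C : CTy Op} : ∀ M : Comp Γ C, M.subst Sub.id = M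
  | .app V W => by simp only [Comp.subst, Val.subst_id V, Val.subst_id W]
  | .ret V => by simp only [Comp.subst, Val.subst_id V]
  | .letIn M N => by simp only [Comp.subst, Sub.id_up, Comp.subst_id M, Comp.subst_id N]
  | .op o V => by simp only [Comp.subst, Val.subst_id V]
  | .handle M H N => by
      simp only [Comp.subst, Sub.id_up, Comp.subst_id M, Handler.subst_id H, Comp.subst_id N]

theorem Handler.subst_id {Γ : Ctx Op} {S : Sig Op} {C : CTy Op} :
    ∀ H : Handler Γ S C, H.subst Sub.id = H
  | .mk M => by simp only [Handler.subst, Sub.id_up, fun o => Comp.subst_id (M o)]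

end

/-- Precomposition of a substitution with a renaming. -/
def Ren.compSub {Γ Δ Θ : Ctx Op} (ρ : Ren Γ Δ) (τ : Sub Δ Θ) : Sub Γ Θ := fun _ x => τ (ρ x)

theorem Ren.up_compSub {Γ Δ Θ : Ctx Op} {B : Ty Op} (ρ : Ren Γ Δ) (τ : Sub Δ Θ) :
    (ρ.up : Ren (B :: Γ) (B :: Δ)).compSub τ.up = (ρ.compSub τ).up := by
  funext A x
  cases x <;> rfl

mutual

theorem Val.rename_subst {Γ Δ Θ : Ctx Op} {A : Ty Op} :
    ∀ (V : Val Γ A) (ρ : Ren Γ Δ) (τ : Sub Δ Θ), (V.rename ρ).subst τ = V.subst (ρ.compSub τ)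
  | .var x, ρ, τ => by simp only [Val.rename, Val.subst, Ren.compSub]
  | .lam M, ρ, τ => by
      simp only [Val.rename, Val.subst, ← Ren.up_compSub, Comp.rename_subst M]
  | .tuple V, ρ, τ => by
      simp only [Val.rename, Val.subst, fun i => Val.rename_subst (V i) ρ τ]
  | .proj (A := _) i V, ρ, τ => by simp only [Val.rename, Val.subst, Val.rename_subst V]

theorem Comp.rename_subst {Γ Δ Θ : Ctx Op} {C : CTy Op} :
    ∀ (M : Comp Γ C) (ρ : Ren Γ Δ) (τ : Sub Δ Θ), (M.rename ρ).subst τ = M.subst (ρ.compSub τ)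
  | .app V W, ρ, τ => by
      simp only [Comp.rename, Comp.subst, Val.rename_subst V, Val.rename_subst W]
  | .ret V, ρ, τ => by simp only [Comp.rename, Comp.subst, Val.rename_subst V]
  | .letIn M N, ρ, τ => by
      simp only [Comp.rename, Comp.subst, ← Ren.up_compSub, Comp.rename_subst M,
        Comp.rename_subst N]
  | .op o V, ρ, τ => by simp only [Comp.rename, Comp.subst, Val.rename_subst V]
  | .handle M H N, ρ, τ => by
      simp only [Comp.rename, Comp.subst, ← Ren.up_compSub, Comp.rename_subst M,
        Handler.rename_subst H, Comp.rename_subst N]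

theorem Handler.rename_subst {Γ Δ Θ : Ctx Op} {S : Sig Op} {C : CTy Op} :
    ∀ (H : Handler Γ S C) (ρ : Ren Γ Δ) (τ : Sub Δ Θ),
      (H.rename ρ).subst τ = H.subst (ρ.compSub τ)
  | .mk M, ρ, τ => by
      simp only [Handler.rename, Handler.subst, ← Ren.up_compSub,
        fun o => Comp.rename_subst (M o) ρ.up.up τ.up.up]

end

/-- Postcomposition of a substitution with a renaming. -/
def Sub.compRen {Γ Δ Θ : Ctx Op} (σ : Sub Γ Δ) (ρ : Ren Δ Θ) : Sub Γ Θ :=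
  fun _ x => (σ x).rename ρ

theorem Sub.up_compRen {Γ Δ Θ : Ctx Op} {B : Ty Op} (σ : Sub Γ Δ) (ρ : Ren Δ Θ) :
    (σ.up : Sub (B :: Γ) (B :: Δ)).compRen ρ.up = (σ.compRen ρ).up := by
  funext A x
  cases x with
  | zero => rfl
  | succ x =>
    change ((σ x).rename Ren.wk).rename ρ.up = ((σ x).rename ρ).rename Ren.wk
    rw [Val.rename_eq_subst _ ρ.up, Val.rename_subst, Val.rename_eq_subst _ Ren.wk,
      Val.rename_subst]
    rfl

mutual

theorem Val.subst_rename {Γ Δ Θ : Ctx Op} {A : Ty Op} :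
    ∀ (V : Val Γ A) (σ : Sub Γ Δ) (ρ : Ren Δ Θ), (V.subst σ).rename ρ = V.subst (σ.compRen ρ)
  | .var x, σ, ρ => by simp only [Val.subst, Sub.compRen]
  | .lam M, σ, ρ => by
      simp only [Val.rename, Val.subst, ← Sub.up_compRen, Comp.subst_rename M]
  | .tuple V, σ, ρ => by
      simp only [Val.rename, Val.subst, fun i => Val.subst_rename (V i) σ ρ]
  | .proj (A := _) i V, σ, ρ => by simp only [Val.rename, Val.subst, Val.subst_rename V]

theorem Comp.subst_rename {Γ Δ Θ : Ctx Op} {C : CTy Op} :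
    ∀ (M : Comp Γ C) (σ : Sub Γ Δ) (ρ : Ren Δ Θ), (M.subst σ).rename ρ = M.subst (σ.compRen ρ)
  | .app V W, σ, ρ => by
      simp only [Comp.rename, Comp.subst, Val.subst_rename V, Val.subst_rename W]
  | .ret V, σ, ρ => by simp only [Comp.rename, Comp.subst, Val.subst_rename V]
  | .letIn M N, σ, ρ => by
      simp only [Comp.rename, Comp.subst, ← Sub.up_compRen, Comp.subst_rename M,
        Comp.subst_rename N]
  | .op o V, σ, ρ => by simp only [Comp.rename, Comp.subst, Val.subst_rename V]
  | .handle M H N, σ, ρ => by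
      simp only [Comp.rename, Comp.subst, ← Sub.up_compRen, Comp.subst_rename M,
        Handler.subst_rename H, Comp.subst_rename N]

theorem Handler.subst_rename {Γ Δ Θ : Ctx Op} {S : Sig Op} {C : CTy Op} :
    ∀ (H : Handler Γ S C) (σ : Sub Γ Δ) (ρ : Ren Δ Θ),
      (H.subst σ).rename ρ = H.subst (σ.compRen ρ)
  | .mk M, σ, ρ => by
      simp only [Handler.rename, Handler.subst, ← Sub.up_compRen,
        fun o => Comp.subst_rename (M o) σ.up.up ρ.up.up]

end

theorem Sub.up_comp {Γ Δ Θ : Ctx Op} {B : Ty Op} (σ : Sub Γ Δ) (τ : Sub Δ Θ) :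
    (σ.up : Sub (B :: Γ) (B :: Δ)).comp τ.up = (σ.comp τ).up := by
  funext A x
  cases x with
  | zero => rfl
  | succ x =>
    change ((σ x).rename Ren.wk).subst τ.up = ((σ x).subst τ).rename Ren.wk
    rw [Val.rename_subst, Val.subst_rename]
    rfl

mutual

theorem Val.subst_subst {Γ Δ Θ : Ctx Op} {A : Ty Op} :
    ∀ (V : Val Γ A) (σ : Sub Γ Δ) (τ : Sub Δ Θ), (V.subst σ).subst τ = V.subst (σ.comp τ)
  | .var x, σ, τ => by simp only [Val.subst, Sub.comp]
  | .lam M, σ, τ => by simp only [Val.subst, ← Sub.up_comp, Comp.subst_subst M]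
  | .tuple V, σ, τ => by simp only [Val.subst, fun i => Val.subst_subst (V i) σ τ]
  | .proj (A := _) i V, σ, τ => by simp only [Val.subst, Val.subst_subst V]

theorem Comp.subst_subst {Γ Δ Θ : Ctx Op} {C : CTy Op} :
    ∀ (M : Comp Γ C) (σ : Sub Γ Δ) (τ : Sub Δ Θ), (M.subst σ).subst τ = M.subst (σ.comp τ)
  | .app V W, σ, τ => by simp only [Comp.subst, Val.subst_subst V, Val.subst_subst W]
  | .ret V, σ, τ => by simp only [Comp.subst, Val.subst_subst V]
  | .letIn M N, σ, τ => by
      simp only [Comp.subst, ← Sub.up_comp, Comp.subst_subst M, Comp.subst_subst N]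
  | .op o V, σ, τ => by simp only [Comp.subst, Val.subst_subst V]
  | .handle M H N, σ, τ => by
      simp only [Comp.subst, ← Sub.up_comp, Comp.subst_subst M, Handler.subst_subst H,
        Comp.subst_subst N]

theorem Handler.subst_subst {Γ Δ Θ : Ctx Op} {S : Sig Op} {C : CTy Op} :
    ∀ (H : Handler Γ S C) (σ : Sub Γ Δ) (τ : Sub Δ Θ), (H.subst σ).subst τ = H.subst (σ.comp τ)
  | .mk M, σ, τ => by
      simp only [Handler.subst, ← Sub.up_comp, fun o => Comp.subst_subst (M o) σ.up.up τ.up.up]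

end

/-! ### Stability of the equational theory under substitution -/

theorem Sub.wk_comp_cons {Γ Δ : Ctx Op} {B : Ty Op} (σ : Sub Γ Δ) (V : Val Δ B) :
    (Ren.wk (B := B)).compSub (σ.cons V) = σ := rfl

theorem Sub.up_comp_cons {Γ Δ Θ : Ctx Op} {B : Ty Op} (σ : Sub Γ Δ) (τ : Sub Δ Θ) (V : Val Θ B) :
    σ.up.comp (τ.cons V) = (σ.comp τ).cons V := by
  funext A x
  cases x with
  | zero => rfl
  | succ x =>
    change ((σ x).rename Ren.wk).subst (τ.cons V) = (σ x).subst τ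
    rw [Val.rename_subst, Sub.wk_comp_cons]

theorem Sub.cons_comp {Γ Δ Θ : Ctx Op} {B : Ty Op} (σ : Sub Γ Δ) (V : Val Δ B) (τ : Sub Δ Θ) :
    (σ.cons V).comp τ = (σ.comp τ).cons (V.subst τ) := by
  funext A x
  cases x <;> rfl

theorem Sub.id_comp {Γ Δ : Ctx Op} (σ : Sub Γ Δ) : Sub.id.comp σ = σ := rfl

theorem Sub.comp_id {Γ Δ : Ctx Op} (σ : Sub Γ Δ) : σ.comp Sub.id = σ := by
  funext A x
  exact Val.subst_id _

theorem Comp.inst_subst {Γ Δ : Ctx Op} {A : Ty Op} {C : CTy Op} (M : Comp (A :: Γ) C)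
    (V : Val Γ A) (σ : Sub Γ Δ) :
    (M.inst V).subst σ = (M.subst σ.up).inst (V.subst σ) := by
  simp only [Comp.inst, Comp.subst_subst, Sub.cons_comp, Sub.up_comp_cons, Sub.id_comp,
    Sub.comp_id]

theorem Comp.inst₂_subst {Γ Δ : Ctx Op} {A B : Ty Op} {C : CTy Op} (M : Comp (B :: A :: Γ) C)
    (V : Val Γ A) (W : Val Γ B) (σ : Sub Γ Δ) :
    (M.inst₂ V W).subst σ = (M.subst σ.up.up).inst₂ (V.subst σ) (W.subst σ) := by
  simp only [Comp.inst₂, Comp.subst_subst, Sub.cons_comp, Sub.up_comp_cons, Sub.id_comp,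
    Sub.comp_id]

theorem Val.rename_wk_subst_up {Γ Δ : Ctx Op} {A B : Ty Op} (V : Val Γ A) (σ : Sub Γ Δ) :
    (V.rename (Ren.wk (B := B))).subst σ.up = (V.subst σ).rename Ren.wk := by
  rw [Val.rename_subst, Val.subst_rename]
  rfl

theorem Handler.rename_wk_subst_up {Γ Δ : Ctx Op} {B : Ty Op} {S : Sig Op} {C : CTy Op}
    (H : Handler Γ S C) (σ : Sub Γ Δ) :
    (H.rename (Ren.wk (B := B))).subst σ.up = (H.subst σ).rename Ren.wk := by
  rw [Handler.rename_subst, Handler.subst_rename]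
  rfl

theorem Comp.rename_up_wk_subst_up {Γ Δ : Ctx Op} {A B : Ty Op} {C : CTy Op}
    (M : Comp (A :: Γ) C) (σ : Sub Γ Δ) :
    (M.rename (Ren.up (Ren.wk (B := B)))).subst σ.up.up =
      (M.subst σ.up).rename (Ren.up Ren.wk) := by
  rw [Comp.rename_subst, Comp.subst_rename, Ren.up_compSub, Sub.up_compRen]
  rfl

mutual

theorem ValEq.subst : ∀ {Γ Δ : Ctx Op} {A : Ty Op} {V W : Val Γ A} (σ : Sub Γ Δ),
    ValEq V W → ValEq (V.subst σ) (W.subst σ)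
  | _, _, _, _, _, _, .refl _ => .refl _
  | _, _, _, _, _, σ, .symm h => .symm (h.subst σ)
  | _, _, _, _, _, σ, .trans h h' => .trans (h.subst σ) (h'.subst σ)
  | _, _, _, _, _, σ, .lam_congr h => by
    simp only [Val.subst]
    exact .lam_congr (h.subst σ.up)
  | _, _, _, _, _, σ, .tuple_congr h => by
    simp only [Val.subst]
    exact .tuple_congr fun i => (h i).subst σ
  | _, _, _, _, _, σ, .proj_congr (A := _) i h => by
    simp only [Val.subst]
    exact .proj_congr i (h.subst σ)
  | _, _, _, _, _, σ, .abs_eta _ => by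
    simp only [Val.subst, Comp.subst, Val.rename_wk_subst_up]
    exact .abs_eta _
  | _, _, _, _, _, σ, .prod_beta (A := _) i V => by
    simp only [Val.subst]
    exact .prod_beta i _
  | _, _, _, _, _, σ, .prod_eta _ => by
    simp only [Val.subst]
    exact .prod_eta _

theorem CompEq.subst : ∀ {Γ Δ : Ctx Op} {C : CTy Op} {M N : Comp Γ C} (σ : Sub Γ Δ),
    CompEq M N → CompEq (M.subst σ) (N.subst σ)
  | _, _, _, _, _, _, .refl _ => .refl _
  | _, _, _, _, _, σ, .symm h => .symm (h.subst σ)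
  | _, _, _, _, _, σ, .trans h h' => .trans (h.subst σ) (h'.subst σ)
  | _, _, _, _, _, σ, .app_congr h h' => by
    simp only [Comp.subst]
    exact .app_congr (h.subst σ) (h'.subst σ)
  | _, _, _, _, _, σ, .ret_congr h => by
    simp only [Comp.subst]
    exact .ret_congr (h.subst σ)
  | _, _, _, _, _, σ, .let_congr h h' => by
    simp only [Comp.subst]
    exact .let_congr (h.subst σ) (h'.subst σ.up)
  | _, _, _, _, _, σ, .op_congr o h => by
    simp only [Comp.subst]
    exact .op_congr o (h.subst σ)
  | _, _, _, _, _, σ, .handle_congr h h' h'' => by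
    simp only [Comp.subst]
    exact .handle_congr (h.subst σ) (h'.subst σ) (h''.subst σ.up)
  | _, _, _, _, _, σ, .abs_beta M V => by
    rw [Comp.inst_subst]
    simp only [Comp.subst, Val.subst]
    exact .abs_beta _ _
  | _, _, _, _, _, σ, .ret_let V M => by
    rw [Comp.inst_subst]
    simp only [Comp.subst]
    exact .ret_let _ _
  | _, _, _, _, _, σ, .let_let M N L => by
    simp only [Comp.subst, Comp.rename_up_wk_subst_up]
    exact .let_let _ _ _
  | _, _, _, _, _, σ, .let_ret M => by
    simp only [Comp.subst]
    exact .let_ret _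
  | _, _, _, _, _, σ, .handle_ret V H M => by
    rw [Comp.inst_subst]
    simp only [Comp.subst]
    exact .handle_ret _ _ _
  | _, _, _, _, _, σ, .handle_let H L M N => by
    simp only [Comp.subst, Comp.rename_up_wk_subst_up, Handler.rename_wk_subst_up]
    exact .handle_let _ _ _ _
  | _, _, _, _, _, σ, .handle_op o H M V => by
    rw [Comp.inst₂_subst]
    simp only [Comp.subst, Handler.subst, Val.subst]
    exact .handle_op o _ _ _

theorem HandlerEq.subst : ∀ {Γ Δ : Ctx Op} {S : Sig Op} {C : CTy Op} {H H' : Handler Γ S C}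
    (σ : Sub Γ Δ), HandlerEq H H' → HandlerEq (H.subst σ) (H'.subst σ)
  | _, _, _, _, _, _, _, .refl _ => .refl _
  | _, _, _, _, _, _, σ, .symm h => .symm (h.subst σ)
  | _, _, _, _, _, _, σ, .trans h h' => .trans (h.subst σ) (h'.subst σ)
  | _, _, _, _, _, _, σ, .congr h => by
    simp only [Handler.subst]
    exact .congr fun o => (h o).subst σ.up.up

end

theorem ValEq.rename {Γ Δ : Ctx Op} {A : Ty Op} {V W : Val Γ A} (h : ValEq V W) (ρ : Ren Γ Δ) :
    ValEq (V.rename ρ) (W.rename ρ) := by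
  rw [Val.rename_eq_subst, Val.rename_eq_subst]
  exact h.subst _

/-- Pointwise derivable equality of substitutions. -/
def SubEq {Γ Δ : Ctx Op} (σ τ : Sub Γ Δ) : Prop := ∀ ⦃A : Ty Op⦄ (x : Var Γ A), ValEq (σ x) (τ x)

theorem SubEq.up {Γ Δ : Ctx Op} {B : Ty Op} {σ τ : Sub Γ Δ} (h : SubEq σ τ) :
    SubEq (σ.up (B := B)) τ.up
  | _, .zero => .refl _
  | _, .succ x => (h x).rename _

mutual

theorem Val.subst_congr {Γ Δ : Ctx Op} {A : Ty Op} :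
    ∀ (V : Val Γ A) {σ τ : Sub Γ Δ}, SubEq σ τ → ValEq (V.subst σ) (V.subst τ)
  | .var x, _, _, h => by simpa only [Val.subst] using h x
  | .lam M, _, _, h => by
      simp only [Val.subst]
      exact .lam_congr (M.subst_congr h.up)
  | .tuple V, _, _, h => by
      simp only [Val.subst]
      exact .tuple_congr fun i => (V i).subst_congr h
  | .proj (A := _) i V, _, _, h => by
      simp only [Val.subst]
      exact .proj_congr i (V.subst_congr h)

theorem Comp.subst_congr {Γ Δ : Ctx Op} {C : CTy Op} :
    ∀ (M : Comp Γ C) {σ τ : Sub Γ Δ}, SubEq σ τ → CompEq (M.subst σ) (M.subst τ)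
  | .app V W, _, _, h => by
      simp only [Comp.subst]
      exact .app_congr (V.subst_congr h) (W.subst_congr h)
  | .ret V, _, _, h => by
      simp only [Comp.subst]
      exact .ret_congr (V.subst_congr h)
  | .letIn M N, _, _, h => by
      simp only [Comp.subst]
      exact .let_congr (M.subst_congr h) (N.subst_congr h.up)
  | .op o V, _, _, h => by
      simp only [Comp.subst]
      exact .op_congr o (V.subst_congr h)
  | .handle M H N, _, _, h => by
      simp only [Comp.subst]
      exact .handle_congr (M.subst_congr h) (H.subst_congr h) (N.subst_congr h.up)

theorem Handler.subst_congr {Γ Δ : Ctx Op} {S : Sig Op} {C : CTy Op} :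
    ∀ (H : Handler Γ S C) {σ τ : Sub Γ Δ}, SubEq σ τ → HandlerEq (H.subst σ) (H.subst τ)
  | .mk M, _, _, h => by
      simp only [Handler.subst]
      exact .congr fun o => (M o).subst_congr h.up.up

end

/-! ### Terms modulo derivable equality -/

/-- Derivable equality of value terms. -/
def valSetoid (Γ : Ctx Op) (A : Ty Op) : Setoid (Val Γ A) where
  r := ValEq
  iseqv := ⟨.refl, .symm, .trans⟩

/-- Derivable equality of computation terms. -/
def compSetoid (Γ : Ctx Op) (C : CTy Op) : Setoid (Comp Γ C) where
  r := CompEq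
  iseqv := ⟨.refl, .symm, .trans⟩

/-- Value terms modulo derivable equality. -/
def QVal (Γ : Ctx Op) (A : Ty Op) : Type u := Quotient (valSetoid Γ A)

/-- Computation terms modulo derivable equality. -/
def QComp (Γ : Ctx Op) (C : CTy Op) : Type u := Quotient (compSetoid Γ C)

/-- The class of a value term. -/
def QVal.mk {Γ : Ctx Op} {A : Ty Op} (V : Val Γ A) : QVal Γ A := Quotient.mk (valSetoid Γ A) V

/-- The class of a computation term. -/
def QComp.mk {Γ : Ctx Op} {C : CTy Op} (M : Comp Γ C) : QComp Γ C :=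
  Quotient.mk (compSetoid Γ C) M

/-- A representative of a class of value terms. -/
noncomputable def QVal.out {Γ : Ctx Op} {A : Ty Op} (V : QVal Γ A) : Val Γ A := Quotient.out V

/-- A representative of a class of computation terms. -/
noncomputable def QComp.out {Γ : Ctx Op} {C : CTy Op} (M : QComp Γ C) : Comp Γ C := Quotient.out M

theorem QVal.mk_eq {Γ : Ctx Op} {A : Ty Op} {V W : Val Γ A} : mk V = mk W ↔ ValEq V W :=
  ⟨fun h => Quotient.exact h, fun h => Quotient.sound (s := valSetoid Γ A) h⟩

theorem QComp.mk_eq {Γ : Ctx Op} {C : CTy Op} {M N : Comp Γ C} : mk M = mk N ↔ CompEq M N :=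
  ⟨fun h => Quotient.exact h, fun h => Quotient.sound (s := compSetoid Γ C) h⟩

theorem QVal.mk_out {Γ : Ctx Op} {A : Ty Op} (V : QVal Γ A) : mk V.out = V := Quotient.out_eq V

theorem QComp.mk_out {Γ : Ctx Op} {C : CTy Op} (M : QComp Γ C) : mk M.out = M := Quotient.out_eq M

theorem QVal.out_mk {Γ : Ctx Op} {A : Ty Op} (V : Val Γ A) : ValEq (mk V).out V :=
  mk_eq.1 (mk_out _)

theorem QComp.out_mk {Γ : Ctx Op} {C : CTy Op} (M : Comp Γ C) : CompEq (mk M).out M :=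
  mk_eq.1 (mk_out _)

theorem QVal.exists_rep {Γ : Ctx Op} {A : Ty Op} (V : QVal Γ A) : ∃ V', V = mk V' :=
  ⟨_, (mk_out V).symm⟩

theorem QComp.exists_rep {Γ : Ctx Op} {C : CTy Op} (M : QComp Γ C) : ∃ M', M = mk M' :=
  ⟨_, (mk_out M).symm⟩

theorem QVal.exists_rep_family {ι : Type*} {Γ : ι → Ctx Op} {A : ι → Ty Op}
    (V : ∀ i, QVal (Γ i) (A i)) : ∃ V' : ∀ i, Val (Γ i) (A i), V = fun i => mk (V' i) :=
  ⟨fun i => (V i).out, funext fun i => (mk_out (V i)).symm⟩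

theorem QComp.exists_rep_family {ι : Type*} {Γ : ι → Ctx Op} {C : ι → CTy Op}
    (M : ∀ i, QComp (Γ i) (C i)) : ∃ M' : ∀ i, Comp (Γ i) (C i), M = fun i => mk (M' i) :=
  ⟨fun i => (M i).out, funext fun i => (mk_out (M i)).symm⟩

namespace QVal

/-- Variables. -/
def var {Γ : Ctx Op} {A : Ty Op} (x : Var Γ A) : QVal Γ A := mk (.var x)

/-- The last variable of a context. -/
def last {Γ : Ctx Op} {A : Ty Op} : QVal (A :: Γ) A := var .zero

/-- Abstraction. -/
noncomputable def lam {Γ : Ctx Op} {A : Ty Op} {C : CTy Op} (M : QComp (A :: Γ) C) :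
    QVal Γ (Ty.fn A C) := mk (.lam M.out)

/-- Tupling. -/
noncomputable def tuple {Γ : Ctx Op} {n : ℕ} {A : Fin n → Ty Op} (V : ∀ i, QVal Γ (A i)) :
    QVal Γ (Ty.prod A) := mk (.tuple fun i => (V i).out)

/-- Projections. -/
noncomputable def proj {Γ : Ctx Op} {n : ℕ} {A : Fin n → Ty Op} (i : Fin n)
    (V : QVal Γ (Ty.prod A)) : QVal Γ (A i) := mk (.proj i V.out)

end QVal

namespace QComp

/-- Application. -/
noncomputable def app {Γ : Ctx Op} {A : Ty Op} {C : CTy Op} (V : QVal Γ (Ty.fn A C))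
    (W : QVal Γ A) : QComp Γ C := mk (.app V.out W.out)

/-- Returning a value. -/
noncomputable def ret {Γ : Ctx Op} {A : Ty Op} {S : Sig Op} (V : QVal Γ A) : QComp Γ ⟨A, S⟩ :=
  mk (.ret V.out)

/-- Sequencing. -/
noncomputable def letIn {Γ : Ctx Op} {A B : Ty Op} {S : Sig Op} (M : QComp Γ ⟨A, S⟩)
    (N : QComp (A :: Γ) ⟨B, S⟩) : QComp Γ ⟨B, S⟩ := mk (.letIn M.out N.out)

/-- Calling an operation. -/
noncomputable def op {Γ : Ctx Op} {S : Sig Op} (o : {o // o ∈ S.dom}) (V : QVal Γ (S.arg o)) :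
    QComp Γ ⟨S.res o, S⟩ := mk (.op o V.out)

/-- Handling, with the handler given by its clauses. -/
noncomputable def handle {Γ : Ctx Op} {A : Ty Op} {S : Sig Op} {C : CTy Op} (M : QComp Γ ⟨A, S⟩)
    (H : ∀ o : {o // o ∈ S.dom}, QComp (Ty.fn (S.res o) C :: S.arg o :: Γ) C)
    (N : QComp (A :: Γ) C) : QComp Γ C := mk (.handle M.out (.mk fun o => (H o).out) N.out)

end QComp

theorem QVal.mk_var {Γ : Ctx Op} {A : Ty Op} (x : Var Γ A) : mk (.var x) = var x := rfl

theorem QVal.mk_lam {Γ : Ctx Op} {A : Ty Op} {C : CTy Op} (M : Comp (A :: Γ) C) :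
    mk (.lam M) = lam (.mk M) :=
  mk_eq.2 (.lam_congr (QComp.out_mk M).symm)

theorem QVal.mk_tuple {Γ : Ctx Op} {n : ℕ} {A : Fin n → Ty Op} (V : ∀ i, Val Γ (A i)) :
    mk (.tuple V) = tuple fun i => mk (V i) :=
  mk_eq.2 (.tuple_congr fun i => (out_mk (V i)).symm)

theorem QVal.mk_proj {Γ : Ctx Op} {n : ℕ} {A : Fin n → Ty Op} (i : Fin n)
    (V : Val Γ (Ty.prod A)) : mk (.proj i V) = proj i (mk V) :=
  mk_eq.2 (.proj_congr i (out_mk V).symm)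

theorem QComp.mk_app {Γ : Ctx Op} {A : Ty Op} {C : CTy Op} (V : Val Γ (Ty.fn A C))
    (W : Val Γ A) : mk (.app V W) = app (.mk V) (.mk W) :=
  mk_eq.2 (.app_congr (QVal.out_mk V).symm (QVal.out_mk W).symm)

theorem QComp.mk_ret {Γ : Ctx Op} {A : Ty Op} {S : Sig Op} (V : Val Γ A) :
    mk (.ret (S := S) V) = ret (.mk V) :=
  mk_eq.2 (.ret_congr (QVal.out_mk V).symm)

theorem QComp.mk_letIn {Γ : Ctx Op} {A B : Ty Op} {S : Sig Op} (M : Comp Γ ⟨A, S⟩)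
    (N : Comp (A :: Γ) ⟨B, S⟩) : mk (.letIn M N) = letIn (mk M) (mk N) :=
  mk_eq.2 (.let_congr (out_mk M).symm (out_mk N).symm)

theorem QComp.mk_op {Γ : Ctx Op} {S : Sig Op} (o : {o // o ∈ S.dom}) (V : Val Γ (S.arg o)) :
    mk (.op o V) = op o (.mk V) :=
  mk_eq.2 (.op_congr o (QVal.out_mk V).symm)

theorem QComp.mk_handle {Γ : Ctx Op} {A : Ty Op} {S : Sig Op} {C : CTy Op} (M : Comp Γ ⟨A, S⟩)
    (H : ∀ o : {o // o ∈ S.dom}, Comp (Ty.fn (S.res o) C :: S.arg o :: Γ) C)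
    (N : Comp (A :: Γ) C) :
    mk (.handle M (.mk H) N) = handle (mk M) (fun o => mk (H o)) (mk N) :=
  mk_eq.2 (.handle_congr (out_mk M).symm (.congr fun o => (out_mk (H o)).symm) (out_mk N).symm)

/-! ### Substitution modulo derivable equality -/

/-- Substitutions of classes of value terms over `Δ` for the variables of `Γ`. -/
def QSub (Γ Δ : Ctx Op) : Type u := ∀ ⦃A : Ty Op⦄, Var Γ A → QVal Δ A

/-- Substitution in value terms. -/
noncomputable def QVal.subst {Γ Δ : Ctx Op} {A : Ty Op} (V : QVal Γ A) (σ : QSub Γ Δ) :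
    QVal Δ A := mk (V.out.subst fun _ x => (σ x).out)

/-- Substitution in computation terms. -/
noncomputable def QComp.subst {Γ Δ : Ctx Op} {C : CTy Op} (M : QComp Γ C) (σ : QSub Γ Δ) :
    QComp Δ C := mk (M.out.subst fun _ x => (σ x).out)

namespace QSub

/-- The class of a substitution. -/
def mk {Γ Δ : Ctx Op} (σ : Sub Γ Δ) : QSub Γ Δ := fun _ x => .mk (σ x)

/-- The empty substitution. -/
def nil {Δ : Ctx Op} : QSub [] Δ := fun _ x => nomatch x

/-- The identity substitution. -/
def id {Γ : Ctx Op} : QSub Γ Γ := fun _ x => .var x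

/-- The weakening substitution. -/
def wk {Γ : Ctx Op} {B : Ty Op} : QSub Γ (B :: Γ) := fun _ x => .var (.succ x)

/-- The substitution that maps the last variable to `V` and is `σ` on the others. -/
def cons {Γ Δ : Ctx Op} {B : Ty Op} (σ : QSub Γ Δ) (V : QVal Δ B) : QSub (B :: Γ) Δ
  | _, .zero => V
  | _, .succ x => σ x

/-- Composition of substitutions. -/
noncomputable def comp {Γ Δ Θ : Ctx Op} (σ : QSub Γ Δ) (τ : QSub Δ Θ) : QSub Γ Θ :=
  fun _ x => (σ x).subst τ

theorem exists_rep {Γ Δ : Ctx Op} (σ : QSub Γ Δ) : ∃ σ', σ = mk σ' :=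
  ⟨fun _ x => (σ x).out, by
    funext A x
    exact (QVal.mk_out _).symm⟩

theorem mk_id {Γ : Ctx Op} : mk (Sub.id (Γ := Γ)) = id := rfl

theorem mk_wk {Γ : Ctx Op} {B : Ty Op} : mk (Ren.toSub (Ren.wk (Γ := Γ) (B := B))) = wk := rfl

theorem mk_cons {Γ Δ : Ctx Op} {B : Ty Op} (σ : Sub Γ Δ) (V : Val Δ B) :
    mk (σ.cons V) = (mk σ).cons (.mk V) := by
  funext A x
  cases x <;> rfl

end QSub

theorem QVal.mk_subst {Γ Δ : Ctx Op} {A : Ty Op} (V : Val Γ A) (σ : Sub Γ Δ) :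
    mk (V.subst σ) = (mk V).subst (.mk σ) :=
  mk_eq.2 ((V.subst_congr fun _ x => (out_mk (σ x)).symm).trans ((out_mk V).symm.subst _))

theorem QComp.mk_subst {Γ Δ : Ctx Op} {C : CTy Op} (M : Comp Γ C) (σ : Sub Γ Δ) :
    mk (M.subst σ) = (mk M).subst (.mk σ) :=
  mk_eq.2 ((M.subst_congr fun _ x => (QVal.out_mk (σ x)).symm).trans ((out_mk M).symm.subst _))

namespace QSub

theorem mk_comp {Γ Δ Θ : Ctx Op} (σ : Sub Γ Δ) (τ : Sub Δ Θ) :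
    mk (σ.comp τ) = (mk σ).comp (mk τ) := by
  funext A x
  exact QVal.mk_subst _ _

theorem mk_up {Γ Δ : Ctx Op} {B : Ty Op} (σ : Sub Γ Δ) :
    mk (σ.up (B := B)) = ((mk σ).comp wk).cons .last := by
  funext A x
  cases x with
  | zero => rfl
  | succ x =>
    change QVal.mk ((σ x).rename Ren.wk) = (QVal.mk (σ x)).subst wk
    rw [Val.rename_eq_subst, QVal.mk_subst, mk_wk]

end QSub

@[simp] theorem QVal.subst_subst {Γ Δ Θ : Ctx Op} {A : Ty Op} (V : QVal Γ A) (σ : QSub Γ Δ)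
    (τ : QSub Δ Θ) : (V.subst σ).subst τ = V.subst (σ.comp τ) := by
  obtain ⟨V, rfl⟩ := V.exists_rep
  obtain ⟨σ, rfl⟩ := σ.exists_rep
  obtain ⟨τ, rfl⟩ := τ.exists_rep
  simp only [← QVal.mk_subst, ← QSub.mk_comp, Val.subst_subst]

@[simp] theorem QComp.subst_subst {Γ Δ Θ : Ctx Op} {C : CTy Op} (M : QComp Γ C) (σ : QSub Γ Δ)
    (τ : QSub Δ Θ) : (M.subst σ).subst τ = M.subst (σ.comp τ) := by
  obtain ⟨M, rfl⟩ := M.exists_rep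
  obtain ⟨σ, rfl⟩ := σ.exists_rep
  obtain ⟨τ, rfl⟩ := τ.exists_rep
  simp only [← QComp.mk_subst, ← QSub.mk_comp, Comp.subst_subst]

@[simp] theorem QVal.subst_id {Γ : Ctx Op} {A : Ty Op} (V : QVal Γ A) : V.subst .id = V := by
  obtain ⟨V, rfl⟩ := V.exists_rep
  rw [← QSub.mk_id, ← QVal.mk_subst, Val.subst_id]

@[simp] theorem QComp.subst_id {Γ : Ctx Op} {C : CTy Op} (M : QComp Γ C) : M.subst .id = M := by
  obtain ⟨M, rfl⟩ := M.exists_rep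
  rw [← QSub.mk_id, ← QComp.mk_subst, Comp.subst_id]

theorem QVal.var_subst {Γ Δ : Ctx Op} {A : Ty Op} (x : Var Γ A) (σ : QSub Γ Δ) :
    (var x).subst σ = σ x := by
  obtain ⟨σ, rfl⟩ := σ.exists_rep
  rw [← QVal.mk_var, ← QVal.mk_subst, Val.subst]
  rfl

@[simp] theorem QVal.last_subst_cons {Γ Δ : Ctx Op} {A : Ty Op} (σ : QSub Γ Δ) (V : QVal Δ A) :
    last.subst (σ.cons V) = V := var_subst _ _

namespace QSub

@[simp] theorem comp_assoc {Γ Δ Θ Ξ : Ctx Op} (σ : QSub Γ Δ) (τ : QSub Δ Θ) (υ : QSub Θ Ξ) :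
    (σ.comp τ).comp υ = σ.comp (τ.comp υ) := by
  funext A x
  exact QVal.subst_subst _ _ _

@[simp] theorem id_comp {Γ Δ : Ctx Op} (σ : QSub Γ Δ) : id.comp σ = σ := by
  funext A x
  exact QVal.var_subst _ _

@[simp] theorem comp_id {Γ Δ : Ctx Op} (σ : QSub Γ Δ) : σ.comp id = σ := by
  funext A x
  exact QVal.subst_id _

@[simp] theorem wk_comp_cons {Γ Δ : Ctx Op} {B : Ty Op} (σ : QSub Γ Δ) (V : QVal Δ B) :
    wk.comp (σ.cons V) = σ := by
  funext A x
  exact QVal.var_subst _ _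

@[simp] theorem cons_comp {Γ Δ Θ : Ctx Op} {B : Ty Op} (σ : QSub Γ Δ) (V : QVal Δ B)
    (τ : QSub Δ Θ) : (σ.cons V).comp τ = (σ.comp τ).cons (V.subst τ) := by
  funext A x
  cases x <;> rfl

theorem eq_nil {Δ : Ctx Op} (σ τ : QSub [] Δ) : σ = τ := by
  funext A x
  cases x

@[simp] theorem nil_comp {Δ Θ : Ctx Op} (τ : QSub Δ Θ) : nil.comp τ = nil := eq_nil _ _

@[simp] theorem wk_eq_nil {B : Ty Op} : (wk : QSub [] [B]) = nil := eq_nil _ _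

@[simp] theorem cons_wk_last {Γ : Ctx Op} {B : Ty Op} :
    (wk : QSub Γ (B :: Γ)).cons .last = id := by
  funext A x
  cases x <;> rfl

@[simp] theorem cons_wk_comp_last {Γ Δ : Ctx Op} {B : Ty Op} (σ : QSub (B :: Γ) Δ) :
    (wk.comp σ).cons (QVal.last.subst σ) = σ := by
  rw [← cons_comp, cons_wk_last, id_comp]

@[simp] theorem cons_nil_last {B : Ty Op} : (nil : QSub [] [B]).cons .last = id := by
  rw [← wk_eq_nil, cons_wk_last]

@[simp] theorem cons_nil_last_subst {Δ : Ctx Op} {B : Ty Op} (σ : QSub [B] Δ) :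
    nil.cons (QVal.last.subst σ) = σ := by
  rw [eq_nil nil (wk.comp σ), cons_wk_comp_last]

end QSub

namespace QVal

@[simp] theorem lam_subst {Γ Δ : Ctx Op} {A : Ty Op} {C : CTy Op} (M : QComp (A :: Γ) C)
    (σ : QSub Γ Δ) : (lam M).subst σ = lam (M.subst ((σ.comp .wk).cons last)) := by
  obtain ⟨M, rfl⟩ := M.exists_rep
  obtain ⟨σ, rfl⟩ := σ.exists_rep
  simp only [← mk_lam, ← mk_subst, ← QComp.mk_subst, ← QSub.mk_up, Val.subst]

@[simp] theorem tuple_subst {Γ Δ : Ctx Op} {n : ℕ} {A : Fin n → Ty Op} (V : ∀ i, QVal Γ (A i))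
    (σ : QSub Γ Δ) : (tuple V).subst σ = tuple fun i => (V i).subst σ := by
  obtain ⟨V, rfl⟩ := exists_rep_family V
  obtain ⟨σ, rfl⟩ := σ.exists_rep
  simp only [← mk_tuple, ← mk_subst, Val.subst]

@[simp] theorem proj_subst {Γ Δ : Ctx Op} {n : ℕ} {A : Fin n → Ty Op} (i : Fin n)
    (V : QVal Γ (Ty.prod A)) (σ : QSub Γ Δ) : (proj i V).subst σ = proj i (V.subst σ) := by
  obtain ⟨V, rfl⟩ := V.exists_rep
  obtain ⟨σ, rfl⟩ := σ.exists_rep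
  simp only [← mk_proj, ← mk_subst, Val.subst]

@[simp] theorem proj_tuple {Γ : Ctx Op} {n : ℕ} {A : Fin n → Ty Op} (i : Fin n)
    (V : ∀ i, QVal Γ (A i)) : proj i (tuple V) = V i := by
  obtain ⟨V, rfl⟩ := exists_rep_family V
  rw [← mk_tuple, ← mk_proj]
  exact mk_eq.2 (.prod_beta i V)

theorem tuple_proj {Γ : Ctx Op} {n : ℕ} {A : Fin n → Ty Op} (V : QVal Γ (Ty.prod A)) :
    tuple (fun i => proj i V) = V := by
  obtain ⟨V, rfl⟩ := V.exists_rep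
  simp only [← mk_tuple, ← mk_proj]
  exact mk_eq.2 (ValEq.prod_eta V).symm

theorem prod_ext {Γ : Ctx Op} {n : ℕ} {A : Fin n → Ty Op} {V W : QVal Γ (Ty.prod A)}
    (h : ∀ i, proj i V = proj i W) : V = W := by
  rw [← tuple_proj V, ← tuple_proj W]
  exact congrArg tuple (funext h)

theorem lam_app {Γ : Ctx Op} {A : Ty Op} {C : CTy Op} (V : QVal Γ (Ty.fn A C)) :
    lam (.app (V.subst .wk) last) = V := by
  obtain ⟨V, rfl⟩ := V.exists_rep
  rw [last, ← mk_var, ← QSub.mk_wk, ← mk_subst, ← Val.rename_eq_subst, ← QComp.mk_app, ← mk_lam]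
  exact mk_eq.2 (ValEq.abs_eta V).symm

end QVal

namespace QComp

@[simp] theorem app_subst {Γ Δ : Ctx Op} {A : Ty Op} {C : CTy Op} (V : QVal Γ (Ty.fn A C))
    (W : QVal Γ A) (σ : QSub Γ Δ) : (app V W).subst σ = app (V.subst σ) (W.subst σ) := by
  obtain ⟨V, rfl⟩ := V.exists_rep
  obtain ⟨W, rfl⟩ := W.exists_rep
  obtain ⟨σ, rfl⟩ := σ.exists_rep
  simp only [← mk_app, ← mk_subst, ← QVal.mk_subst, Comp.subst]

@[simp] theorem ret_subst {Γ Δ : Ctx Op} {A : Ty Op} {S : Sig Op} (V : QVal Γ A)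
    (σ : QSub Γ Δ) : (ret (S := S) V).subst σ = ret (V.subst σ) := by
  obtain ⟨V, rfl⟩ := V.exists_rep
  obtain ⟨σ, rfl⟩ := σ.exists_rep
  simp only [← mk_ret, ← mk_subst, ← QVal.mk_subst, Comp.subst]

@[simp] theorem letIn_subst {Γ Δ : Ctx Op} {A B : Ty Op} {S : Sig Op} (M : QComp Γ ⟨A, S⟩)
    (N : QComp (A :: Γ) ⟨B, S⟩) (σ : QSub Γ Δ) :
    (letIn M N).subst σ = letIn (M.subst σ) (N.subst ((σ.comp .wk).cons .last)) := by
  obtain ⟨M, rfl⟩ := M.exists_rep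
  obtain ⟨N, rfl⟩ := N.exists_rep
  obtain ⟨σ, rfl⟩ := σ.exists_rep
  simp only [← mk_letIn, ← mk_subst, ← QSub.mk_up, Comp.subst]

@[simp] theorem op_subst {Γ Δ : Ctx Op} {S : Sig Op} (o : {o // o ∈ S.dom})
    (V : QVal Γ (S.arg o)) (σ : QSub Γ Δ) : (op o V).subst σ = op o (V.subst σ) := by
  obtain ⟨V, rfl⟩ := V.exists_rep
  obtain ⟨σ, rfl⟩ := σ.exists_rep
  simp only [← mk_op, ← mk_subst, ← QVal.mk_subst, Comp.subst]

@[simp] theorem handle_subst {Γ Δ : Ctx Op} {A : Ty Op} {S : Sig Op} {C : CTy Op}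
    (M : QComp Γ ⟨A, S⟩)
    (H : ∀ o : {o // o ∈ S.dom}, QComp (Ty.fn (S.res o) C :: S.arg o :: Γ) C)
    (N : QComp (A :: Γ) C) (σ : QSub Γ Δ) :
    (handle M H N).subst σ =
      handle (M.subst σ)
        (fun o => (H o).subst ((((σ.comp .wk).cons .last).comp .wk).cons .last))
        (N.subst ((σ.comp .wk).cons .last)) := by
  obtain ⟨M, rfl⟩ := M.exists_rep
  obtain ⟨H, rfl⟩ := exists_rep_family H
  obtain ⟨N, rfl⟩ := N.exists_rep
  obtain ⟨σ, rfl⟩ := σ.exists_rep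
  simp only [← mk_handle, ← mk_subst, ← QSub.mk_up, Comp.subst, Handler.subst]

@[simp] theorem app_lam {Γ : Ctx Op} {A : Ty Op} {C : CTy Op} (M : QComp (A :: Γ) C)
    (V : QVal Γ A) : app (.lam M) V = M.subst (QSub.id.cons V) := by
  obtain ⟨M, rfl⟩ := M.exists_rep
  obtain ⟨V, rfl⟩ := V.exists_rep
  rw [← QVal.mk_lam, ← mk_app, ← QSub.mk_id, ← QSub.mk_cons, ← mk_subst]
  exact mk_eq.2 (.abs_beta M V)

@[simp] theorem letIn_ret {Γ : Ctx Op} {A B : Ty Op} {S : Sig Op} (V : QVal Γ A)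
    (M : QComp (A :: Γ) ⟨B, S⟩) : letIn (ret V) M = M.subst (QSub.id.cons V) := by
  obtain ⟨M, rfl⟩ := M.exists_rep
  obtain ⟨V, rfl⟩ := V.exists_rep
  rw [← mk_ret, ← mk_letIn, ← QSub.mk_id, ← QSub.mk_cons, ← mk_subst]
  exact mk_eq.2 (.ret_let V M)

@[simp] theorem letIn_ret_last {Γ : Ctx Op} {A : Ty Op} {S : Sig Op} (M : QComp Γ ⟨A, S⟩) :
    letIn M (ret .last) = M := by
  obtain ⟨M, rfl⟩ := M.exists_rep
  rw [QVal.last, ← QVal.mk_var, ← mk_ret, ← mk_letIn]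
  exact mk_eq.2 (.let_ret M)

theorem mk_rename_up_wk {Γ : Ctx Op} {A B : Ty Op} {C : CTy Op} (M : Comp (A :: Γ) C) :
    mk (M.rename (Ren.up (Ren.wk (B := B)))) =
      (mk M).subst ((QSub.wk.comp .wk).cons .last) := by
  rw [Comp.rename_eq_subst, mk_subst, Ren.toSub_up, QSub.mk_up, QSub.mk_wk]

@[simp] theorem letIn_letIn {Γ : Ctx Op} {A₁ A₂ A₃ : Ty Op} {S : Sig Op} (M : QComp Γ ⟨A₁, S⟩)
    (N : QComp (A₁ :: Γ) ⟨A₂, S⟩) (L : QComp (A₂ :: Γ) ⟨A₃, S⟩) :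
    letIn (letIn M N) L = letIn M (letIn N (L.subst ((QSub.wk.comp .wk).cons .last))) := by
  obtain ⟨M, rfl⟩ := M.exists_rep
  obtain ⟨N, rfl⟩ := N.exists_rep
  obtain ⟨L, rfl⟩ := L.exists_rep
  simp only [← mk_letIn, ← mk_rename_up_wk]
  exact mk_eq.2 (.let_let M N L)

@[simp] theorem handle_ret {Γ : Ctx Op} {A : Ty Op} {S : Sig Op} {C : CTy Op} (V : QVal Γ A)
    (H : ∀ o : {o // o ∈ S.dom}, QComp (Ty.fn (S.res o) C :: S.arg o :: Γ) C)
    (M : QComp (A :: Γ) C) : handle (ret V) H M = M.subst (QSub.id.cons V) := by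
  obtain ⟨M, rfl⟩ := M.exists_rep
  obtain ⟨V, rfl⟩ := V.exists_rep
  obtain ⟨H, rfl⟩ := exists_rep_family H
  rw [← mk_ret, ← mk_handle, ← QSub.mk_id, ← QSub.mk_cons, ← mk_subst]
  exact mk_eq.2 (.handle_ret V _ M)

@[simp] theorem handle_letIn {Γ : Ctx Op} {A B : Ty Op} {S : Sig Op} {C : CTy Op}
    (H : ∀ o : {o // o ∈ S.dom}, QComp (Ty.fn (S.res o) C :: S.arg o :: Γ) C)
    (L : QComp Γ ⟨A, S⟩) (M : QComp (A :: Γ) ⟨B, S⟩) (N : QComp (B :: Γ) C) :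
    handle (letIn L M) H N =
      handle L H (handle M
        (fun o => (H o).subst ((((QSub.wk.comp .wk).cons .last).comp .wk).cons .last))
        (N.subst ((QSub.wk.comp .wk).cons .last))) := by
  obtain ⟨L, rfl⟩ := L.exists_rep
  obtain ⟨M, rfl⟩ := M.exists_rep
  obtain ⟨N, rfl⟩ := N.exists_rep
  obtain ⟨H, rfl⟩ := exists_rep_family H
  have := mk_eq.2 (CompEq.handle_let (.mk H) L M N)
  rw [Handler.rename_eq_subst, Handler.subst] at this
  simpa only [mk_letIn, mk_handle, mk_rename_up_wk, mk_subst, QSub.mk_up, QSub.mk_wk] using this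

@[simp] theorem handle_op {Γ : Ctx Op} {S : Sig Op} {C : CTy Op} (o : {o // o ∈ S.dom})
    (H : ∀ o : {o // o ∈ S.dom}, QComp (Ty.fn (S.res o) C :: S.arg o :: Γ) C)
    (M : QComp (S.res o :: Γ) C) (V : QVal Γ (S.arg o)) :
    handle (op o V) H M = (H o).subst ((QSub.id.cons V).cons (.lam M)) := by
  obtain ⟨M, rfl⟩ := M.exists_rep
  obtain ⟨V, rfl⟩ := V.exists_rep
  obtain ⟨H, rfl⟩ := exists_rep_family H
  rw [← mk_op, ← mk_handle, ← QVal.mk_lam, ← QSub.mk_id, ← QSub.mk_cons, ← QSub.mk_cons,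
    ← mk_subst]
  exact mk_eq.2 (.handle_op o H M V)

end QComp

/-! ### Thunks -/

/-- The unit type. -/
abbrev Ty.unit : Ty Op := .prod (Fin.elim0 : Fin 0 → Ty Op)

/-- The type of thunks of computations. -/
def Ty.thunk (S : Sig Op) (A : Ty Op) : Ty Op := .fn .unit ⟨A, S⟩

namespace QVal

/-- The element of the unit type. -/
noncomputable def unit {Γ : Ctx Op} : QVal Γ .unit := tuple fun i => i.elim0

theorem eq_unit {Γ : Ctx Op} (V W : QVal Γ .unit) : V = W := prod_ext fun i => i.elim0

/-- Suspension of a computation. -/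
noncomputable def thunk {Γ : Ctx Op} {A : Ty Op} {S : Sig Op} (M : QComp Γ ⟨A, S⟩) :
    QVal Γ (.thunk S A) :=
  lam (M.subst .wk)

@[simp] theorem thunk_subst {Γ Δ : Ctx Op} {A : Ty Op} {S : Sig Op} (M : QComp Γ ⟨A, S⟩)
    (σ : QSub Γ Δ) : (thunk M).subst σ = thunk (M.subst σ) := by
  refine (lam_subst _ _).trans ?_
  simp [thunk]

end QVal

/-- Running a suspended computation. -/
noncomputable def QComp.force {Γ : Ctx Op} {A : Ty Op} {S : Sig Op} (V : QVal Γ (.thunk S A)) :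
    QComp Γ ⟨A, S⟩ :=
  app (A := .unit) V .unit

@[simp] theorem QComp.force_subst {Γ Δ : Ctx Op} {A : Ty Op} {S : Sig Op}
    (V : QVal Γ (.thunk S A)) (σ : QSub Γ Δ) : (force V).subst σ = force (V.subst σ) :=
  (app_subst (A := .unit) V .unit σ).trans (congrArg (app (A := .unit) _) (QVal.eq_unit _ _))

@[simp] theorem QComp.force_thunk {Γ : Ctx Op} {A : Ty Op} {S : Sig Op} (M : QComp Γ ⟨A, S⟩) :
    force (.thunk M) = M :=
  (app_lam _ _).trans (by simp)

@[simp] theorem QVal.thunk_force {Γ : Ctx Op} {A : Ty Op} {S : Sig Op}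
    (V : QVal Γ (.thunk S A)) : thunk (.force V) = V := by
  refine Eq.trans ?_ (lam_app (A := .unit) V)
  rw [thunk, QComp.force_subst, ← QVal.eq_unit QVal.unit last]
  rfl

/-! ### The category of types and terms -/

namespace Syn

noncomputable instance category : Category.{u} (Ty Op) where
  Hom A B := QVal [A] B
  id A := .last
  comp f g := g.subst (QSub.nil.cons f)
  id_comp f := by simp
  comp_id f := by simp
  assoc f g h := by simp

/-- A term in a context of length one, as a morphism. -/
def hom {A B : Ty Op} (V : QVal [A] B) : A ⟶ B := V

/-- A morphism, as a term in a context of length one. -/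
def term {A B : Ty Op} (f : A ⟶ B) : QVal [A] B := f

@[simp] theorem term_hom {A B : Ty Op} (V : QVal [A] B) : term (hom V) = V := rfl

theorem term_injective {A B : Ty Op} {f g : A ⟶ B} (h : term f = term g) : f = g := h

@[simp] theorem term_id (A : Ty Op) : term (𝟙 A) = .last := rfl

@[simp] theorem term_comp {A B C : Ty Op} (f : A ⟶ B) (g : B ⟶ C) :
    term (f ≫ g) = (term g).subst (QSub.nil.cons (term f)) := rfl

noncomputable instance cartesianCat : CartesianCat (Ty Op) where
  pi A := .prod A
  π A i := hom (.proj i .last)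
  tuple f := hom (.tuple fun i => term (f i))
  tuple_π f i := term_injective (by simp)
  hom_ext f g h := term_injective <| QVal.prod_ext fun i => by
    simpa using congrArg term (h i)

end Syn

namespace QVal

/-- Pairing. -/
noncomputable def pair {Γ : Ctx Op} {A B : Ty Op} (V : QVal Γ A) (W : QVal Γ B) :
    QVal Γ (A ⊗ B) :=
  tuple (Fin.cons (α := fun i => QVal Γ (![A, B] i)) V
    (Fin.cons (α := fun i : Fin 1 => QVal Γ (![B] i)) W fun i => i.elim0))

/-- The first projection. -/
noncomputable def fst {Γ : Ctx Op} {A B : Ty Op} (V : QVal Γ (A ⊗ B)) : QVal Γ A :=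
  proj (A := ![A, B]) 0 V

/-- The second projection. -/
noncomputable def snd {Γ : Ctx Op} {A B : Ty Op} (V : QVal Γ (A ⊗ B)) : QVal Γ B :=
  proj (A := ![A, B]) 1 V

@[simp] theorem fst_pair {Γ : Ctx Op} {A B : Ty Op} (V : QVal Γ A) (W : QVal Γ B) :
    fst (pair V W) = V := proj_tuple (A := ![A, B]) 0 _

@[simp] theorem snd_pair {Γ : Ctx Op} {A B : Ty Op} (V : QVal Γ A) (W : QVal Γ B) :
    snd (pair V W) = W := proj_tuple (A := ![A, B]) 1 _

theorem pair_ext {Γ : Ctx Op} {A B : Ty Op} {V W : QVal Γ (A ⊗ B)} (h : fst V = fst W)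
    (h' : snd V = snd W) : V = W := by
  refine prod_ext (A := ![A, B]) fun i => ?_
  refine Fin.cases h (fun j => ?_) i
  obtain rfl : j = 0 := Subsingleton.elim _ _
  exact h'

@[simp] theorem pair_fst_snd {Γ : Ctx Op} {A B : Ty Op} (V : QVal Γ (A ⊗ B)) :
    pair (fst V) (snd V) = V := pair_ext (fst_pair _ _) (snd_pair _ _)

@[simp] theorem fst_subst {Γ Δ : Ctx Op} {A B : Ty Op} (V : QVal Γ (A ⊗ B)) (σ : QSub Γ Δ) :
    (fst V).subst σ = fst (V.subst σ) := proj_subst (A := ![A, B]) 0 V σ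

@[simp] theorem snd_subst {Γ Δ : Ctx Op} {A B : Ty Op} (V : QVal Γ (A ⊗ B)) (σ : QSub Γ Δ) :
    (snd V).subst σ = snd (V.subst σ) := proj_subst (A := ![A, B]) 1 V σ

@[simp] theorem pair_subst {Γ Δ : Ctx Op} {A B : Ty Op} (V : QVal Γ A) (W : QVal Γ B)
    (σ : QSub Γ Δ) : (pair V W).subst σ = pair (V.subst σ) (W.subst σ) :=
  pair_ext (by rw [← fst_subst, fst_pair, fst_pair]) (by rw [← snd_subst, snd_pair, snd_pair])

end QVal

namespace Syn

@[simp] theorem term_fst (A B : Ty Op) : term (fst A B) = .fst .last := rfl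

@[simp] theorem term_snd (A B : Ty Op) : term (snd A B) = .snd .last := rfl

@[simp] theorem term_lift {A B Z : Ty Op} (f : Z ⟶ A) (g : Z ⟶ B) :
    term (lift f g) = .pair (term f) (term g) := by
  refine QVal.pair_ext ?_ ?_
  · have := congrArg term (lift_fst f g)
    rw [term_comp] at this
    simpa using this
  · have := congrArg term (lift_snd f g)
    rw [term_comp] at this
    simpa using this

@[simp] theorem term_tensorHom {X X' Y Y' : Ty Op} (f : X ⟶ X') (g : Y ⟶ Y') :
    term (f ⊗ₘ g) = .pair ((term f).subst (QSub.nil.cons (.fst .last)))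
      ((term g).subst (QSub.nil.cons (.snd .last))) := by
  rw [← lift_fst_comp_snd_comp]
  simp [-lift_fst_comp_snd_comp]

@[simp] theorem term_whiskerLeft (X : Ty Op) {Y Y' : Ty Op} (g : Y ⟶ Y') :
    term (X ◁ g) = .pair (.fst .last) ((term g).subst (QSub.nil.cons (.snd .last))) := by
  rw [← id_tensorHom]
  simp [-id_tensorHom]

@[simp] theorem term_whiskerRight {X X' : Ty Op} (f : X ⟶ X') (Y : Ty Op) :
    term (f ▷ Y) = .pair ((term f).subst (QSub.nil.cons (.fst .last))) (.snd .last) := by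
  rw [← tensorHom_id]
  simp [-tensorHom_id]

@[simp] theorem term_leftUnitor_hom (X : Ty Op) : term (λ_ X).hom = .snd .last := by
  rw [leftUnitor_hom, term_snd]

@[simp] theorem term_associator_hom (X Y Z : Ty Op) :
    term (α_ X Y Z).hom =
      .pair (.fst (.fst .last)) (.pair (.snd (.fst .last)) (.snd .last)) := by
  have : (α_ X Y Z).hom =
      lift (fst _ _ ≫ fst _ _) (lift (fst _ _ ≫ snd _ _) (snd _ _)) := by
    ext <;> simp
  rw [this]
  simp

@[simp] theorem term_associator_inv (X Y Z : Ty Op) :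
    term (α_ X Y Z).inv =
      .pair (.pair (.fst .last) (.fst (.snd .last))) (.snd (.snd .last)) := by
  have : (α_ X Y Z).inv =
      lift (lift (fst _ _) (snd _ _ ≫ fst _ _)) (snd _ _ ≫ snd _ _) := by
    ext <;> simp
  rw [this]
  simp

/-! ### The monads of thunks -/

/-- The functor of thunks. -/
noncomputable def functor (S : Sig Op) : Ty Op ⥤ Ty Op where
  obj A := .thunk S A
  map f := hom (.thunk (.letIn (.force .last) (.ret ((term f).subst (QSub.nil.cons .last)))))
  map_id A := term_injective (by simp)
  map_comp f g := term_injective (by simp)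

theorem functor_obj (S : Sig Op) (A : Ty Op) : (functor S).obj A = .thunk S A := rfl

theorem term_functor_map (S : Sig Op) {A B : Ty Op} (f : A ⟶ B) :
    term ((functor S).map f) =
      .thunk (.letIn (.force .last) (.ret ((term f).subst (QSub.nil.cons .last)))) := rfl

/-- The unit of the monad of thunks. -/
noncomputable def unit (S : Sig Op) : 𝟭 (Ty Op) ⟶ functor S where
  app A := hom (.thunk (.ret .last))
  naturality A B f := term_injective (by
    simp only [term_comp, term_functor_map, Functor.id_map]
    simp [functor_obj])

/-- The multiplication of the monad of thunks. -/
noncomputable def mult (S : Sig Op) : functor S ⋙ functor S ⟶ functor S where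
  app A := hom (.thunk (.letIn (.force .last) (.force .last)))
  naturality A B f := term_injective (by
    simp only [term_comp, term_functor_map, Functor.comp_map]
    simp [functor_obj])

theorem term_unit_app (S : Sig Op) (A : Ty Op) :
    term ((unit S).app A) = .thunk (.ret .last) := rfl

theorem term_mult_app (S : Sig Op) (A : Ty Op) :
    term ((mult S).app A) = .thunk (.letIn (.force .last) (.force .last)) := rfl

/-- The monad of thunks. -/
noncomputable def monad (S : Sig Op) : Monad (Ty Op) where
  toFunctor := functor S
  η := unit S
  μ := mult S
  left_unit A := term_injective (by
    simp only [term_comp, term_unit_app, term_mult_app, term_id]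
    simp [functor_obj])
  right_unit A := term_injective (by
    simp only [term_comp, term_functor_map, term_unit_app, term_mult_app, term_id]
    simp [functor_obj])
  assoc A := term_injective (by
    simp only [term_comp, term_functor_map, term_mult_app]
    simp [functor_obj])

theorem monad_obj (S : Sig Op) (A : Ty Op) : (monad S).obj A = .thunk S A := rfl

theorem term_monad_map (S : Sig Op) {A B : Ty Op} (f : A ⟶ B) :
    term ((monad S).map f) =
      .thunk (.letIn (.force .last) (.ret ((term f).subst (QSub.nil.cons .last)))) := rfl

theorem term_monad_η (S : Sig Op) (A : Ty Op) :
    term ((monad S).η.app A) = .thunk (.ret .last) := rfl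

theorem term_monad_μ (S : Sig Op) (A : Ty Op) :
    term ((monad S).μ.app A) = .thunk (.letIn (.force .last) (.force .last)) := rfl

/-- The strength of the monad of thunks. -/
noncomputable def strength (S : Sig Op) (X Y : Ty Op) :
    X ⊗ (monad S).obj Y ⟶ (monad S).obj (X ⊗ Y) :=
  hom (.thunk (.letIn (.force (.snd .last)) (.ret (.pair (.fst (.subst .last .wk)) .last))))

theorem term_strength (S : Sig Op) (X Y : Ty Op) :
    term (strength S X Y) =
      .thunk (.letIn (.force (.snd (B := .thunk S Y) .last))
        (.ret (.pair (.fst (B := .thunk S Y) (.subst .last .wk)) .last))) := rfl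

/-- The strong monad of thunks. -/
noncomputable def strongMonad (S : Sig Op) : StrongMonad (Ty Op) where
  T := monad S
  st := strength S
  st_natural f g := term_injective (by
    simp only [term_comp, term_tensorHom, term_monad_map, term_strength]
    simp [monad_obj])
  st_leftUnitor X := term_injective (by
    simp only [term_comp, term_leftUnitor_hom, term_monad_map, term_strength]
    simp [monad_obj])
  st_associator X Y Z := term_injective (by
    simp only [term_comp, term_associator_hom, term_whiskerLeft, term_monad_map, term_strength]
    simp [monad_obj])
  st_unit X Y := term_injective (by
    simp only [term_comp, term_whiskerLeft, term_monad_η, term_strength]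
    simp [monad_obj])
  st_mult X Y := term_injective (by
    simp only [term_comp, term_whiskerLeft, term_monad_μ, term_monad_map, term_strength]
    simp [monad_obj])

/-- Currying of terms. -/
noncomputable def curryEquiv (S : Sig Op) (X Y Z : Ty Op) :
    QVal [X ⊗ Y] (.thunk S Z) ≃ QVal [X] (.fn Y ⟨Z, S⟩) where
  toFun V := .lam (.force (V.subst (QSub.nil.cons (.pair (.subst .last .wk) .last))))
  invFun W := .thunk (.app (W.subst (QSub.nil.cons (.fst .last))) (.snd .last))
  left_inv V := by simp
  right_inv W := by simp [QVal.lam_app]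

theorem curryEquiv_apply (S : Sig Op) (X Y Z : Ty Op) (V : QVal [X ⊗ Y] (.thunk S Z)) :
    curryEquiv S X Y Z V =
      .lam (.force (V.subst (QSub.nil.cons (.pair (.subst .last .wk) .last)))) := rfl

theorem curryEquiv_natural (S : Sig Op) (X X' Y Z : Ty Op) (f : X ⟶ X')
    (g : QVal [X' ⊗ Y] (.thunk S Z)) :
    curryEquiv S X Y Z (g.subst (QSub.nil.cons (term (f ▷ Y)))) =
      (curryEquiv S X' Y Z g).subst (QSub.nil.cons (term f)) := by
  simp [curryEquiv_apply]

/-- Function types as Kleisli exponentials. -/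
noncomputable def kleisliExp (S : Sig Op) (Y Z : Ty Op) : KleisliExp (strongMonad S).T Y Z where
  obj := .fn Y ⟨Z, S⟩
  curry {X} := curryEquiv S X Y Z
  curry_natural f g := curryEquiv_natural S _ _ Y Z f g

theorem strongMonad_obj (S : Sig Op) (A : Ty Op) :
    (strongMonad S).T.obj A = .thunk S A := rfl

theorem term_map (S : Sig Op) {A B : Ty Op} (f : A ⟶ B) :
    term ((strongMonad S).T.map f) =
      .thunk (.letIn (.force .last) (.ret ((term f).subst (QSub.nil.cons .last)))) := rfl

theorem term_η (S : Sig Op) (A : Ty Op) :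
    term ((strongMonad S).T.η.app A) = .thunk (.ret .last) := rfl

theorem term_μ (S : Sig Op) (A : Ty Op) :
    term ((strongMonad S).T.μ.app A) = .thunk (.letIn (.force .last) (.force .last)) := rfl

theorem term_st (S : Sig Op) (X Y : Ty Op) :
    term ((strongMonad S).st X Y) =
      .thunk (.letIn (.force (.snd (B := .thunk S Y) .last))
        (.ret (.pair (.fst (B := .thunk S Y) (.subst .last .wk)) .last))) := rfl

theorem kleisliExp_obj (S : Sig Op) (Y Z : Ty Op) : (kleisliExp S Y Z).obj = .fn Y ⟨Z, S⟩ := rfl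

theorem term_kleisliExp_curry (S : Sig Op) {X Y Z : Ty Op}
    (f : X ⊗ Y ⟶ (strongMonad S).T.obj Z) :
    term ((kleisliExp S Y Z).curry f) =
      .lam (.force ((term f).subst (QSub.nil.cons (.pair (.subst .last .wk) .last)))) := rfl

theorem term_kleisliExp_eval (S : Sig Op) (Y Z : Ty Op) :
    term (kleisliExp S Y Z).eval =
      .thunk (.app (.fst (A := .fn Y ⟨Z, S⟩) .last) (.snd (A := .fn Y ⟨Z, S⟩) .last)) :=
  congrArg (fun V : QVal [Ty.fn Y ⟨Z, S⟩ ⊗ Y] (Ty.fn Y ⟨Z, S⟩) =>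
    QVal.thunk (.app V (.snd .last))) (QVal.last_subst_cons _ _)

/-- The component at `o` of a term of the type of handlers. -/
noncomputable def component {S S' : Sig Op} {X : Ty Op} (o : {o // o ∈ S.dom}) {Γ : Ctx Op}
    (V : QVal Γ (HBundle (kleisliExp S') S X)) :
    QVal Γ (Ty.fn (S.arg o ⊗ Ty.fn (S.res o) ⟨X, S'⟩) ⟨X, S'⟩) :=
  (term (πFinite (clauseObj (kleisliExp S') S X) o)).subst (QSub.nil.cons V)

theorem term_πFinite_subst {S S' : Sig Op} {X : Ty Op} (o : {o // o ∈ S.dom}) {Γ : Ctx Op}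
    (V : QVal Γ (HBundle (kleisliExp S') S X)) :
    (term (πFinite (clauseObj (kleisliExp S') S X) o)).subst (QSub.nil.cons V) =
      component o V := rfl

@[simp] theorem component_subst {S S' : Sig Op} {X : Ty Op} (o : {o // o ∈ S.dom}) {Γ Δ : Ctx Op}
    (V : QVal Γ (HBundle (kleisliExp S') S X)) (σ : QSub Γ Δ) :
    (component o V).subst σ = component o (V.subst σ) :=
  (QVal.subst_subst _ _ _).trans (by
    rw [QSub.cons_comp, QSub.nil_comp]
    rfl)

/-- The handling morphisms. -/
noncomputable def handling (S S' : Sig Op) (X : Ty Op) :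
    HBundle (kleisliExp S') S X ⊗ (strongMonad S).T.obj ((strongMonad S').T.obj X) ⟶
      (strongMonad S').T.obj X :=
  hom (B := .thunk S' X) (.thunk (.handle (A := .thunk S' X) (S := S)
    (.force (.snd (B := .thunk S (.thunk S' X)) .last))
    (fun o => .app (component o (.fst (.subst .last (QSub.wk.comp .wk))))
      (.pair (.subst .last .wk) .last)) (.force .last)))

/-- The operations, as morphisms. -/
noncomputable def operation (S : Sig Op) (o : {o // o ∈ S.dom}) :
    S.arg o ⟶ (strongMonad S).T.obj (S.res o) :=
  hom (.thunk (.op o .last))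

theorem term_operation (S : Sig Op) (o : {o // o ∈ S.dom}) :
    term (operation S o) = .thunk (.op o .last) := rfl

theorem term_handling (S S' : Sig Op) (X : Ty Op) :
    term (handling S S' X) =
      .thunk (.handle (A := .thunk S' X) (S := S)
        (.force (.snd (B := .thunk S (.thunk S' X)) .last))
        (fun o => .app (component o (.fst (.subst .last (QSub.wk.comp .wk))))
      (.pair (.subst .last .wk) .last)) (.force .last)) := rfl

theorem handling_unit (S S' : Sig Op) (X : Ty Op) :
    (HBundle (kleisliExp S') S X ◁ (strongMonad S).T.η.app ((strongMonad S').T.obj X)) ≫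
      handling S S' X = snd _ _ := term_injective (by
  simp only [term_comp, term_whiskerLeft, term_η, term_handling]
  simp [strongMonad_obj])

theorem handling_mult (S S' : Sig Op) (X : Ty Op) :
    (HBundle (kleisliExp S') S X ◁ (strongMonad S).T.μ.app ((strongMonad S').T.obj X)) ≫
      handling S S' X =
      lift (fst _ _) ((strongMonad S).st _ _) ≫
        (HBundle (kleisliExp S') S X ◁ (strongMonad S).T.map (handling S S' X)) ≫
          handling S S' X := term_injective (by
  simp only [term_comp, term_whiskerLeft, term_μ,
    term_map, term_st, term_handling, term_lift, term_fst]
  simp [strongMonad_obj])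

theorem handling_operation (S S' : Sig Op) (X : Ty Op) (o : {o // o ∈ S.dom}) :
    (HBundle (kleisliExp S') S X ◁ mixedOp (kleisliExp S') (operation S o) X) ≫
      handling S S' X =
      (πFinite (clauseObj (kleisliExp S') S X) o ▷
        (S.arg o ⊗ (kleisliExp S' (S.res o) X).obj)) ≫ (kleisliExp S' _ X).eval :=
  term_injective (by
  unfold mixedOp
  simp only [term_comp, term_whiskerLeft, term_whiskerRight, 
    term_map, term_st, term_handling, term_lift, term_fst, term_snd,
    term_operation, term_kleisliExp_eval, term_πFinite_subst]
  have eta := QVal.lam_app (Γ := [_]) (QVal.snd (QVal.snd (A := HBundle (kleisliExp S') S X)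
    (B := S.arg o ⊗ Ty.fn (S.res o) ⟨X, S'⟩) .last))
  simp only [QVal.snd_subst] at eta
  simp [strongMonad_obj, kleisliExp_obj, eta])

end Syn

/-- The term model. -/
noncomputable def synModel (Op : Type u) : Model Op where
  C := Ty Op
  T := Syn.strongMonad
  exp := Syn.kleisliExp
  op := Syn.operation
  handle := Syn.handling
  handle_unit := Syn.handling_unit
  handle_mult := Syn.handling_mult
  handle_op := Syn.handling_operation

/-! ### The interpretation in the term model -/

namespace Syn

/-- The interpretation of value types. -/
noncomputable def ty (A : Ty Op) : Ty Op := (synModel Op).ty A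

/-- The interpretation of signatures. -/
noncomputable abbrev sig (S : Sig Op) : Sig Op := ⟨S.dom, fun o => ty (S.arg o), fun o => ty (S.res o)⟩

/-- The interpretation of computation types. -/
noncomputable abbrev cty (C : CTy Op) : CTy Op := ⟨ty C.val, sig C.sig⟩

/-- The interpretation of contexts. -/
noncomputable def ctx (Γ : Ctx Op) : Ty Op := (synModel Op).ctx Γ

/-- The interpretation of value terms. -/
noncomputable def val {Γ : Ctx Op} {A : Ty Op} (V : Val Γ A) : QVal [ctx Γ] (ty A) :=
  (synModel Op).val V

/-- The interpretation of computation terms. -/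
noncomputable def comp {Γ : Ctx Op} {C : CTy Op} (M : Comp Γ C) :
    QVal [ctx Γ] (.thunk (sig C.sig) (ty C.val)) :=
  (synModel Op).comp M

/-- The interpretation of handlers. -/
noncomputable def handler {Γ : Ctx Op} {S : Sig Op} {C : CTy Op} (H : Handler Γ S C) :
    QVal [ctx Γ] (HBundle (kleisliExp (sig C.sig)) (sig S) (ty C.val)) :=
  (synModel Op).handler H

theorem ctx_cons (Γ : Ctx Op) (A : Ty Op) : ctx (A :: Γ) = ctx Γ ⊗ ty A := rfl

theorem val_var_succ {Γ : Ctx Op} {A B : Ty Op} (x : Var Γ A) :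
    val (.var (.succ x : Var (B :: Γ) A)) =
      (val (.var x)).subst (QSub.nil.cons (.fst (A := ctx Γ) (B := ty B) .last)) := by
  rfl

theorem val_lam {Γ : Ctx Op} {A : Ty Op} {C : CTy Op} (M : Comp (A :: Γ) C) :
    val (.lam M) = QVal.lam (A := ty A) (C := cty C) (.force ((comp M).subst
      (QSub.nil.cons (.pair (A := ctx Γ) (B := ty A) (.subst .last .wk) .last)))) := by
  rfl

theorem val_tuple {Γ : Ctx Op} {n : ℕ} {A : Fin n → Ty Op} (V : ∀ i, Val Γ (A i)) :
    val (.tuple V) = QVal.tuple (A := fun i => ty (A i)) fun i => val (V i) := by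
  rfl

theorem val_proj {Γ : Ctx Op} {n : ℕ} {A : Fin n → Ty Op} (i : Fin n) (V : Val Γ (Ty.prod A)) :
    val (.proj i V) = QVal.proj (A := fun i => ty (A i)) i (val V) := by
  change (QVal.proj (A := fun i => ty (A i)) i .last).subst (QSub.nil.cons (val V)) = _
  rw [QVal.proj_subst]
  exact congrArg (QVal.proj (A := fun i => ty (A i)) i) (QVal.last_subst_cons _ _)

theorem comp_app {Γ : Ctx Op} {A : Ty Op} {C : CTy Op} (V : Val Γ (Ty.fn A C)) (W : Val Γ A) :
    comp (.app V W) = .thunk (.app (A := ty A) (C := cty C) (val V) (val W)) := by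
  change term (lift (hom (B := (kleisliExp (sig C.sig) (ty A) (ty C.val)).obj) (val V))
    (hom (val W)) ≫ (kleisliExp (sig C.sig) (ty A) (ty C.val)).eval) = _
  simp only [term_comp, term_lift, term_kleisliExp_eval]
  simp [kleisliExp_obj, strongMonad_obj]
  rfl

theorem comp_ret {Γ : Ctx Op} {A : Ty Op} {S : Sig Op} (V : Val Γ A) :
    comp (.ret (S := S) V) = .thunk (.ret (val V)) := by
  change term (hom (val V) ≫ (strongMonad (sig S)).T.η.app (ty A)) = _
  simp only [term_comp, term_η]
  simp [strongMonad_obj]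

theorem term_comp_operation (S : Sig Op) (o : {o // o ∈ S.dom}) {X : Ty Op} (f : X ⟶ S.arg o) :
    term (f ≫ operation S o) = .thunk (.op o (term f)) := by
  simp only [term_comp, term_operation]
  simp [strongMonad_obj]

theorem comp_op {Γ : Ctx Op} {S : Sig Op} (o : {o // o ∈ S.dom}) (V : Val Γ (S.arg o)) :
    comp (.op o V) = .thunk (.op (S := sig S) o (val V)) :=
  term_comp_operation (sig S) o (hom (val V))

theorem comp_letIn {Γ : Ctx Op} {A B : Ty Op} {S : Sig Op} (M : Comp Γ ⟨A, S⟩)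
    (N : Comp (A :: Γ) ⟨B, S⟩) :
    comp (.letIn M N) = .thunk (.letIn (A := ty A) (B := ty B) (S := sig S) (.force (comp M)) (.force ((comp N).subst
      (QSub.nil.cons (.pair (A := ctx Γ) (B := ty A) (.subst .last .wk) .last))))) := by
  change term (lift (𝟙 (ctx Γ)) (hom (B := (strongMonad (sig S)).T.obj (ty A)) (comp M)) ≫
    (strongMonad (sig S)).st (ctx Γ) (ty A) ≫
    (strongMonad (sig S)).T.map (hom (A := ctx Γ ⊗ ty A)
      (B := (strongMonad (sig S)).T.obj (ty B)) (comp N)) ≫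
        (strongMonad (sig S)).T.μ.app _) = _
  simp only [term_comp, term_lift, term_st, term_map, term_μ, term_id]
  simp [strongMonad_obj, ctx_cons]
  rfl

theorem comp_handle {Γ : Ctx Op} {A : Ty Op} {S : Sig Op} {C : CTy Op} (M : Comp Γ ⟨A, S⟩)
    (H : Handler Γ S C) (N : Comp (A :: Γ) C) :
    comp (.handle M H N) = .thunk (.handle (S := sig S) (.force (comp M))
      (fun o => .app (component o ((handler H).subst (QSub.wk.comp .wk)))
        (.pair (.subst .last .wk) .last))
      (.force ((comp N).subst
        (QSub.nil.cons (.pair (A := ctx Γ) (B := ty A) (.subst .last .wk) .last))))) := by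
  change term (lift (hom (handler H))
    (lift (𝟙 (ctx Γ)) (hom (B := (strongMonad (sig S)).T.obj (ty A)) (comp M)) ≫
    (strongMonad (sig S)).st (ctx Γ) (ty A) ≫
    (strongMonad (sig S)).T.map (hom (A := ctx Γ ⊗ ty A)
      (B := (strongMonad (sig C.sig)).T.obj (ty C.val)) (comp N))) ≫
        handling (sig S) (sig C.sig) (ty C.val)) = _
  simp only [term_comp, term_lift, term_st, term_map, term_handling, term_id]
  simp [strongMonad_obj, ctx_cons]
  rfl

theorem component_handler {Γ : Ctx Op} {S : Sig Op} {C : CTy Op}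
    (M : ∀ o : {o // o ∈ S.dom}, Comp (Ty.fn (S.res o) C :: S.arg o :: Γ) C)
    (o : {o // o ∈ S.dom}) :
    component (S := sig S) o (handler (.mk M)) =
      .lam (C := cty C) (.force ((comp (M o)).subst (QSub.nil.cons
        (.pair (A := ctx Γ ⊗ ty (S.arg o)) (B := Ty.fn (ty (S.res o)) (cty C))
          (.pair (.subst .last .wk) (.fst .last)) (.snd .last))))) := by
  refine (congrArg term (tupleFinite_πFinite
    (X := clauseObj (kleisliExp (sig C.sig)) (sig S) (ty C.val)) (Z := ctx Γ) (fun o =>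
      (kleisliExp (sig C.sig) (ty (S.arg o) ⊗ (kleisliExp (sig C.sig) (ty (S.res o))
        (ty C.val)).obj) (ty C.val)).curry
          ((α_ (ctx Γ) (ty (S.arg o)) (kleisliExp (sig C.sig) (ty (S.res o)) (ty C.val)).obj).inv ≫
            hom (B := (strongMonad (sig C.sig)).T.obj (ty C.val)) (comp (M o)))) o)).trans ?_
  change term ((kleisliExp (sig C.sig) (ty (S.arg o) ⊗ (kleisliExp (sig C.sig) (ty (S.res o))
    (ty C.val)).obj) (ty C.val)).curry
      ((α_ (ctx Γ) (ty (S.arg o)) (kleisliExp (sig C.sig) (ty (S.res o)) (ty C.val)).obj).inv ≫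
        hom (B := (strongMonad (sig C.sig)).T.obj (ty C.val)) (comp (M o)))) = _
  simp only [term_comp, term_kleisliExp_curry, term_associator_inv]
  simp [strongMonad_obj, kleisliExp_obj, ctx_cons]
  rfl

/-! ### The translation of terms along the interpretation of types -/

/-- The substitution that splits a tuple of the type of a context into its components. -/
noncomputable def split : (Γ : Ctx Op) → QSub (Γ.map ty) [ctx Γ]
  | [] => .nil
  | A :: Γ => ((split Γ).comp (QSub.nil.cons (.fst (A := ctx Γ) (B := ty A) .last))).cons
      (.snd (A := ctx Γ) (B := ty A) .last)

/-- The translation of variables. -/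
noncomputable def trVar : {Γ : Ctx Op} → {A : Ty Op} → Var Γ A → Var (Γ.map ty) (ty A)
  | _, _, .zero => .zero
  | _, _, .succ x => .succ (trVar x)

mutual

/-- The translation of value terms. -/
noncomputable def trVal : {Γ : Ctx Op} → {A : Ty Op} → Val Γ A → QVal (Γ.map ty) (ty A)
  | _, _, .var x => .var (trVar x)
  | _, _, .lam (A := A) (C := C) M => QVal.lam (A := ty A) (C := cty C) (trComp M)
  | _, _, .tuple (A := A) V => QVal.tuple (A := fun i => ty (A i)) fun i => trVal (V i)
  | _, _, .proj (A := A) i V => QVal.proj (A := fun i => ty (A i)) i (trVal V)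

/-- The translation of computation terms. -/
noncomputable def trComp : {Γ : Ctx Op} → {C : CTy Op} → Comp Γ C → QComp (Γ.map ty) (cty C)
  | _, _, .app (A := A) (C := C) V W => .app (A := ty A) (C := cty C) (trVal V) (trVal W)
  | _, _, .ret V => .ret (trVal V)
  | _, _, .letIn (A := A) (B := B) (S := S) M N =>
      .letIn (A := ty A) (B := ty B) (S := sig S) (trComp M) (trComp N)
  | _, _, .op (S := S) o V => .op (S := sig S) o (trVal V)
  | _, _, .handle (A := A) (S := S) (C := C) M H N =>
      .handle (A := ty A) (S := sig S) (C := cty C) (trComp M) (trHandler H) (trComp N)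

/-- The translation of handlers, as families of clauses. -/
noncomputable def trHandler : {Γ : Ctx Op} → {S : Sig Op} → {C : CTy Op} → Handler Γ S C →
    ∀ o : {o // o ∈ (sig S).dom},
      QComp (Ty.fn ((sig S).res o) (cty C) :: (sig S).arg o :: Γ.map ty) (cty C)
  | _, _, _, .mk M => fun o => trComp (M o)

end

theorem split_cons_comp (Γ : Ctx Op) (A : Ty Op) {Δ : Ctx Op} (V : QVal Δ (ctx Γ))
    (W : QVal Δ (ty A)) :
    (split (A :: Γ)).comp (QSub.nil.cons (.pair (A := ctx Γ) (B := ty A) V W)) =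
      ((split Γ).comp (QSub.nil.cons V)).cons W :=
  (QSub.cons_comp ((split Γ).comp (QSub.nil.cons (.fst (A := ctx Γ) (B := ty A) .last)))
    (.snd (A := ctx Γ) (B := ty A) .last) (QSub.nil.cons (.pair (A := ctx Γ) (B := ty A) V W))).trans (by simp)

theorem val_var_eq : ∀ {Γ : Ctx Op} {A : Ty Op} (x : Var Γ A),
    val (.var x) = split Γ (trVar x)
  | _, _, .zero => rfl
  | _, _, .succ x => by
      rw [val_var_succ, val_var_eq x]
      rfl

/-- A term whose interpretation is known, in the context extended by one variable. -/
theorem force_comp_subst_pair {Γ Δ : Ctx Op} {A : Ty Op} {C : CTy Op} {M : Comp (A :: Γ) C}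
    (h : comp M = .thunk ((trComp M).subst (split (A :: Γ)))) (V : QVal Δ (ctx Γ))
    (W : QVal Δ (ty A)) :
    QComp.force ((comp M).subst (QSub.nil.cons (.pair (A := ctx Γ) (B := ty A) V W))) =
      (trComp M).subst (((split Γ).comp (QSub.nil.cons V)).cons W) := by
  rw [← split_cons_comp, h, QVal.thunk_subst, QComp.force_thunk]
  exact QComp.subst_subst _ _ _

theorem force_comp_subst {Γ : Ctx Op} {A : Ty Op} {C : CTy Op} {M : Comp (A :: Γ) C}
    (h : comp M = .thunk ((trComp M).subst (split (A :: Γ)))) :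
    QComp.force ((comp M).subst
        (QSub.nil.cons (.pair (A := ctx Γ) (B := ty A) (.subst .last .wk) .last))) =
      (trComp M).subst (((split Γ).comp .wk).cons .last) :=
  (force_comp_subst_pair h _ _).trans
    (congrArg (fun σ => (trComp M).subst (((split Γ).comp σ).cons .last))
      (QSub.cons_nil_last_subst _))

theorem force_comp {Γ : Ctx Op} {C : CTy Op} {M : Comp Γ C}
    (h : comp M = .thunk ((trComp M).subst (split Γ))) :
    QComp.force (comp M) = (trComp M).subst (split Γ) := by
  rw [h, QComp.force_thunk]

mutual

theorem val_eq : ∀ {Γ : Ctx Op} {A : Ty Op} (V : Val Γ A), val V = (trVal V).subst (split Γ)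
  | _, _, .var x => by rw [val_var_eq, trVal, QVal.var_subst]
  | Γ, _, .lam (A := A) (C := C) M => by
      rw [val_lam, trVal]
      exact (congrArg QVal.lam (force_comp_subst (comp_eq M))).trans (QVal.lam_subst _ _).symm
  | Γ, _, .tuple (A := A) V => by
      rw [val_tuple, trVal]
      exact (congrArg (QVal.tuple (A := fun i => ty (A i))) (funext fun i => val_eq (V i))).trans
        (QVal.tuple_subst _ _).symm
  | Γ, _, .proj (A := _) i V => by
      rw [val_proj, val_eq V, trVal]
      exact (QVal.proj_subst _ _ _).symm

theorem comp_eq : ∀ {Γ : Ctx Op} {C : CTy Op} (M : Comp Γ C),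
    comp M = .thunk ((trComp M).subst (split Γ))
  | _, _, .app V W => by
      rw [comp_app, val_eq V, val_eq W, trComp]
      exact congrArg QVal.thunk (QComp.app_subst _ _ _).symm
  | _, _, .ret V => by
      rw [comp_ret, val_eq V, trComp]
      exact congrArg QVal.thunk (QComp.ret_subst _ _).symm
  | Γ, _, .letIn M N => by
      rw [comp_letIn, trComp]
      exact congrArg QVal.thunk ((congrArg₂ QComp.letIn (force_comp (comp_eq M))
        (force_comp_subst (M := N) (comp_eq N))).trans (QComp.letIn_subst _ _ _).symm)
  | _, _, .op o V => by
      rw [comp_op, val_eq V, trComp]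
      exact congrArg QVal.thunk (QComp.op_subst _ _ _).symm
  | Γ, C, .handle (S := S) M H N => by
      rw [comp_handle, trComp]
      refine congrArg QVal.thunk (Eq.trans ?_ (QComp.handle_subst _ _ _ _).symm)
      rw [force_comp (comp_eq M), force_comp_subst (comp_eq N),
        funext fun o => app_component_handler H o]

theorem app_component_handler : ∀ {Γ : Ctx Op} {S : Sig Op} {C : CTy Op} (H : Handler Γ S C)
    (o : {o // o ∈ S.dom}),
    QComp.app (component (S := sig S) (S' := sig C.sig) (X := ty C.val) o
        ((handler H).subst (QSub.wk.comp .wk))) (.pair (.subst .last .wk) .last) =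
      (trHandler H o).subst
        (((((split Γ).comp .wk).cons .last).comp .wk).cons .last)
  | Γ, S, C, .mk M, o => by
      rw [← component_subst, component_handler, trHandler]
      have e {Δ : Ctx Op} {X Y Z : Ty Op} (σ : QSub [X] Δ) (U : QVal Δ Y) (W : QVal Δ Z) :
          ((QSub.nil.cons (.pair (.pair (.subst (.last (Γ := [])) .wk) (.fst .last))
            (.snd .last))).comp ((σ.comp .wk).cons .last)).comp (QSub.id.cons (.pair U W)) =
            QSub.nil.cons (.pair (.pair (.subst .last σ) U) W) := by
        simp
      refine (congrArg (fun V => QComp.app V _) (QVal.lam_subst _ _)).trans ?_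
      refine (QComp.app_lam _ _).trans ?_
      simp only [QComp.force_subst, QVal.subst_subst]
      refine (congrArg (fun σ => QComp.force ((comp (M o)).subst σ)) (e _ _ _)).trans ?_
      refine (force_comp_subst_pair (comp_eq (M o)) (.pair (A := ctx Γ) (B := ty (S.arg o))
        (.subst .last (QSub.wk.comp .wk)) (.subst .last .wk)) .last).trans ?_
      rw [split_cons_comp]
      simp
      rfl

end

/-! ### Faithfulness of the interpretation -/

/-- The tuple of the variables of a context. -/
noncomputable def join : (Γ : Ctx Op) → QVal (Γ.map ty) (ctx Γ)
  | [] => QVal.unit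
  | A :: Γ => QVal.pair (A := ctx Γ) (B := ty A) ((join Γ).subst .wk) .last

theorem split_comp_join : ∀ Γ : Ctx Op, (split Γ).comp (QSub.nil.cons (join Γ)) = .id
  | [] => QSub.eq_nil _ _
  | A :: Γ => by
      refine (split_cons_comp Γ A _ _).trans ?_
      have h : QSub.nil.cons ((join Γ).subst (QSub.wk (B := ty A))) =
          (QSub.nil.cons (join Γ)).comp .wk := by simp
      rw [h, ← QSub.comp_assoc, split_comp_join Γ, QSub.id_comp, QSub.cons_wk_last]

theorem trVal_eq_of_val_eq {Γ : Ctx Op} {A : Ty Op} {V W : Val Γ A}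
    (h : (synModel Op).val V = (synModel Op).val W) : trVal V = trVal W := by
  have h' : val V = val W := h
  rw [val_eq, val_eq] at h'
  simpa [split_comp_join] using congrArg (QVal.subst · (QSub.nil.cons (join Γ))) h'

theorem trComp_eq_of_comp_eq {Γ : Ctx Op} {C : CTy Op} {M N : Comp Γ C}
    (h : (synModel Op).comp M = (synModel Op).comp N) : trComp M = trComp N := by
  have h' : QComp.force (comp M) = QComp.force (comp N) := congrArg QComp.force h
  rw [force_comp (comp_eq M), force_comp (comp_eq N)] at h'
  simpa [split_comp_join] using congrArg (QComp.subst · (QSub.nil.cons (join Γ))) h'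

theorem ty_eq : ∀ A : Ty Op, ty A = A
  | .prod A => congrArg Ty.prod (funext fun i => ty_eq (A i))
  | .arr A B dom arg res => by
      change Ty.arr (ty A) (ty B) dom (fun o => ty (arg o)) (fun o => ty (res o)) = _
      rw [ty_eq A, ty_eq B, funext fun o => ty_eq (arg o), funext fun o => ty_eq (res o)]

theorem sig_eq (S : Sig Op) : sig S = S := by
  simp only [sig, ty_eq]

theorem cty_eq (C : CTy Op) : cty C = C := by
  simp only [cty, ty_eq, sig_eq]

theorem map_ty_eq (Γ : Ctx Op) : Γ.map ty = Γ := by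
  rw [funext ty_eq, List.map_id']

theorem trVar_heq : ∀ {Γ : Ctx Op} {A : Ty Op} (x : Var Γ A), HEq (trVar x) x
  | _, _, .zero (Γ := Γ) (A := A) => by
      have aux : ∀ {Γ' : Ctx Op} {A' : Ty Op}, Γ' = Γ → A' = A →
          HEq (Var.zero : Var (A' :: Γ') A') (Var.zero : Var (A :: Γ) A) := by
        rintro _ _ rfl rfl
        rfl
      exact aux (map_ty_eq Γ) (ty_eq A)
  | _, _, .succ (Γ := Γ) (A := A) (B := B) x => by
      have aux : ∀ {Γ' : Ctx Op} {A' B' : Ty Op} (x' : Var Γ' A'), Γ' = Γ → A' = A → B' = B →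
          HEq x' x → HEq (Var.succ (B := B') x') (Var.succ (B := B) x) := by
        rintro _ _ _ _ rfl rfl rfl h
        rw [eq_of_heq h]
      exact aux (trVar x) (map_ty_eq Γ) (ty_eq A) (ty_eq B) (trVar_heq x)

theorem pi_heq {ι : Type*} {Q Q' : ι → Type u} {f : ∀ i, Q i} {g : ∀ i, Q' i}
    (h : ∀ i, HEq (f i) (g i)) : HEq f g := by
  obtain rfl : Q = Q' := funext fun i => type_eq_of_heq (h i)
  exact heq_of_eq (funext fun i => eq_of_heq (h i))

mutual

theorem trVal_heq : ∀ {Γ : Ctx Op} {A : Ty Op} (V : Val Γ A), HEq (trVal V) (QVal.mk V)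
  | Γ, A, .var x => by
      have aux : ∀ {Γ' : Ctx Op} {A' : Ty Op} (x' : Var Γ' A'), Γ' = Γ → A' = A → HEq x' x →
          HEq (QVal.var x') (QVal.var x) := by
        rintro _ _ _ rfl rfl h
        rw [eq_of_heq h]
      rw [trVal]
      exact aux _ (map_ty_eq Γ) (ty_eq A) (trVar_heq x)
  | Γ, _, .lam (A := A) (C := C) M => by
      have aux : ∀ {Γ' : Ctx Op} {A' : Ty Op} {C' : CTy Op} (M' : QComp (A' :: Γ') C'), Γ' = Γ →
          A' = A → C' = C → HEq M' (QComp.mk M) → HEq (QVal.lam M') (QVal.mk (.lam M)) := by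
        rintro _ _ _ _ rfl rfl rfl h
        rw [eq_of_heq h, QVal.mk_lam]
      rw [trVal]
      exact aux _ (map_ty_eq Γ) (ty_eq A) (cty_eq C) (trComp_heq M)
  | Γ, _, .tuple (A := A) V => by
      have aux : ∀ {Γ' : Ctx Op} {A' : Fin _ → Ty Op} (V' : ∀ i, QVal Γ' (A' i)), Γ' = Γ →
          A' = A → HEq V' (fun i => QVal.mk (V i)) →
          HEq (QVal.tuple V') (QVal.mk (.tuple V)) := by
        rintro _ _ _ rfl rfl h
        rw [eq_of_heq h, QVal.mk_tuple]
      rw [trVal]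
      exact aux _ (map_ty_eq Γ) (funext fun i => ty_eq (A i)) (pi_heq fun i => trVal_heq (V i))
  | Γ, _, .proj (A := A) i V => by
      have aux : ∀ {Γ' : Ctx Op} {A' : Fin _ → Ty Op} (V' : QVal Γ' (.prod A')), Γ' = Γ →
          A' = A → HEq V' (QVal.mk V) → HEq (QVal.proj i V') (QVal.mk (.proj i V)) := by
        rintro _ _ _ rfl rfl h
        rw [eq_of_heq h, QVal.mk_proj]
      rw [trVal]
      exact aux _ (map_ty_eq Γ) (funext fun i => ty_eq (A i)) (trVal_heq V)

theorem trComp_heq : ∀ {Γ : Ctx Op} {C : CTy Op} (M : Comp Γ C), HEq (trComp M) (QComp.mk M)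
  | Γ, C, .app (A := A) V W => by
      have aux : ∀ {Γ' : Ctx Op} {A' : Ty Op} {C' : CTy Op} (V' : QVal Γ' (Ty.fn A' C'))
          (W' : QVal Γ' A'), Γ' = Γ → A' = A → C' = C → HEq V' (QVal.mk V) →
          HEq W' (QVal.mk W) → HEq (QComp.app V' W') (QComp.mk (.app V W)) := by
        rintro _ _ _ _ _ rfl rfl rfl h h'
        rw [eq_of_heq h, eq_of_heq h', QComp.mk_app]
      rw [trComp]
      exact aux _ _ (map_ty_eq Γ) (ty_eq A) (cty_eq C) (trVal_heq V) (trVal_heq W)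
  | Γ, _, .ret (A := A) (S := S) V => by
      have aux : ∀ {Γ' : Ctx Op} {A' : Ty Op} {S' : Sig Op} (V' : QVal Γ' A'), Γ' = Γ →
          A' = A → S' = S → HEq V' (QVal.mk V) →
          HEq (QComp.ret (S := S') V') (QComp.mk (.ret (S := S) V)) := by
        rintro _ _ _ _ rfl rfl rfl h
        rw [eq_of_heq h, QComp.mk_ret]
      rw [trComp]
      exact aux _ (map_ty_eq Γ) (ty_eq A) (sig_eq S) (trVal_heq V)
  | Γ, _, .letIn (A := A) (B := B) (S := S) M N => by
      have aux : ∀ {Γ' : Ctx Op} {A' B' : Ty Op} {S' : Sig Op} (M' : QComp Γ' ⟨A', S'⟩)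
          (N' : QComp (A' :: Γ') ⟨B', S'⟩), Γ' = Γ → A' = A → B' = B → S' = S →
          HEq M' (QComp.mk M) → HEq N' (QComp.mk N) →
          HEq (QComp.letIn M' N') (QComp.mk (.letIn M N)) := by
        rintro _ _ _ _ _ _ rfl rfl rfl rfl h h'
        rw [eq_of_heq h, eq_of_heq h', QComp.mk_letIn]
      rw [trComp]
      exact aux _ _ (map_ty_eq Γ) (ty_eq A) (ty_eq B) (sig_eq S) (trComp_heq M) (trComp_heq N)
  | Γ, _, .op (S := S) o V => by
      have aux : ∀ {Γ' : Ctx Op} (arg res : {o // o ∈ S.dom} → Ty Op) (V' : QVal Γ' (arg o)),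
          Γ' = Γ → arg = S.arg → res = S.res → HEq V' (QVal.mk V) →
          HEq (QComp.op (S := ⟨S.dom, arg, res⟩) o V') (QComp.mk (.op o V)) := by
        rintro _ _ _ _ rfl rfl rfl h
        rw [eq_of_heq h, QComp.mk_op]
      rw [trComp]
      exact aux _ _ _ (map_ty_eq Γ) (funext fun o => ty_eq _) (funext fun o => ty_eq _)
        (trVal_heq V)
  | Γ, C, .handle (A := A) (S := S) M (.mk H) N => by
      have aux : ∀ {Γ' : Ctx Op} {A' : Ty Op} (arg res : {o // o ∈ S.dom} → Ty Op) {C' : CTy Op}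
          (M' : QComp Γ' ⟨A', ⟨S.dom, arg, res⟩⟩)
          (H' : ∀ o : {o // o ∈ S.dom}, QComp (Ty.fn (res o) C' :: arg o :: Γ') C')
          (N' : QComp (A' :: Γ') C'), Γ' = Γ → A' = A → arg = S.arg → res = S.res → C' = C →
          HEq M' (QComp.mk M) → HEq H' (fun o => QComp.mk (H o)) → HEq N' (QComp.mk N) →
          HEq (QComp.handle (S := ⟨S.dom, arg, res⟩) M' H' N')
            (QComp.mk (.handle M (.mk H) N)) := by
        rintro _ _ _ _ _ _ _ _ rfl rfl rfl rfl rfl h h' h''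
        rw [eq_of_heq h, eq_of_heq h', eq_of_heq h'', QComp.mk_handle]
      rw [trComp]
      exact aux _ _ _ _ _ (map_ty_eq Γ) (ty_eq A) (funext fun o => ty_eq _)
        (funext fun o => ty_eq _) (cty_eq C) (trComp_heq M)
        (pi_heq fun o => by
          rw [trHandler]
          exact trComp_heq (H o)) (trComp_heq N)

end

theorem valEq_of_val_eq {Γ : Ctx Op} {A : Ty Op} {V W : Val Γ A}
    (h : (synModel Op).val V = (synModel Op).val W) : ValEq V W :=
  QVal.mk_eq.1 (eq_of_heq ((trVal_heq V).symm.trans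
    ((heq_of_eq (trVal_eq_of_val_eq h)).trans (trVal_heq W))))

theorem compEq_of_comp_eq {Γ : Ctx Op} {C : CTy Op} {M N : Comp Γ C}
    (h : (synModel Op).comp M = (synModel Op).comp N) : CompEq M N :=
  QComp.mk_eq.1 (eq_of_heq ((trComp_heq M).symm.trans
    ((heq_of_eq (trComp_eq_of_comp_eq h)).trans (trComp_heq N))))

end Syn

/-- In any model, the interpretations of the clauses are determined by that of the handler. -/
theorem Model.comp_eq_of_handler_eq (𝓜 : Model Op) {Γ : Ctx Op} {S : Sig Op} {C : CTy Op}
    {M N : ∀ o : {o // o ∈ S.dom}, Comp (Ty.fn (S.res o) C :: S.arg o :: Γ) C}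
    (h : 𝓜.handler (.mk M) = 𝓜.handler (.mk N)) (o : {o // o ∈ S.dom}) :
    𝓜.comp (M o) = 𝓜.comp (N o) := by
  simp only [Model.handler] at h
  have h' := congrArg (· ≫ πFinite _ o) h
  simp only [tupleFinite_πFinite] at h'
  exact (cancel_epi _).1 ((Equiv.injective _) h')

end EffCalc

theorem mainTheorem1 {Op : Type*} (Γ : EffCalc.Ctx Op) :
    (∀ (A : EffCalc.Ty Op) (V W : EffCalc.Val Γ A),
      (∀ 𝓜 : EffCalc.Model Op, 𝓜.val V = 𝓜.val W) → EffCalc.ValEq V W) ∧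
    (∀ (C : EffCalc.CTy Op) (M N : EffCalc.Comp Γ C),
      (∀ 𝓜 : EffCalc.Model Op, 𝓜.comp M = 𝓜.comp N) → EffCalc.CompEq M N) ∧
    (∀ (S : EffCalc.Sig Op) (C : EffCalc.CTy Op) (H H' : EffCalc.Handler Γ S C),
      (∀ 𝓜 : EffCalc.Model Op, 𝓜.handler H = 𝓜.handler H') → EffCalc.HandlerEq H H') := by
  refine ⟨fun A V W h => EffCalc.Syn.valEq_of_val_eq (h _),
    fun C M N h => EffCalc.Syn.compEq_of_comp_eq (h _), ?_⟩
  rintro S C ⟨M⟩ ⟨N⟩ h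
  exact .congr fun o => EffCalc.Syn.compEq_of_comp_eq
    ((EffCalc.synModel Op).comp_eq_of_handler_eq (h _) o)
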